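/- Let $q,r\ge 2$ be integers. Let $\mathbb T_q$ be the homogeneous tree of degree $q+1$ with a root $o_1$ and a reference end $\omega_1$, and let $\mathbb T_r$ be the homogeneous tree of degree $r+1$ with a root $o_2$ and a reference end $\omega_2$. In either tree let $\mathfrak h(x)=d(x,c)-d(o_i,c)$ be the Busemann function, where $c$ is the first common vertex of the geodesic rays from $x$ and from the root to the reference end, and let $x^-$ be the predecessor of $x$, i.e. its unique neighbour with $\mathfrak h(x^-)=\mathfrak h(x)-1$. The Diestel–Leader graph $\mathrm{DL}(q,r)$ has vertex set $\{x_1x_2\in\mathbb T_q\times\mathbb T_r:\mathfrak h(x_1)+\mathfrak h(x_2)=0\}$, with $x_1x_2\sim y_1y_2$ iff $x_1\sim y_1$ and $x_2\sim y_2$, and reference point $o=o_1o_2$. For $\alpha\in(0,1)$ let $P_\alpha$ be the random walk on $\mathrm{DL}(q,r)$ with transition probabilities $$p_\alpha(x,y)=\begin{cases}\alpha/q,&\text{if } y_1^-=x_1\text{ and }y_2=x_2^-,\\(1-\alpha)/r,&\text{if }y_1=x_1^-\text{ and }y_2^-=x_2,\\0,&\text{otherwise,}\end{cases}$$ and let $p_\alpha^{(n)}(x,y)$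 denote its $n$-step transition probabilities. Put $$\xi_1=\Bigl(\frac{2\pi^2}{\log q}\Bigr)^{1/3},\qquad B_1=3\Bigl(\frac{\pi\log q}{2}\Bigr)^{2/3},\qquad C_1=6\Bigl(\frac{(\log q)^2}{4\pi}\Bigr)^{2/3}.$$ Then, as $N\to\infty$ (where $\sim$ means that the quotient tends to $1$): (i) If $r>q$, then $$p_\alpha^{(2N)}(o,o)\sim A_1\,\bigl(4\alpha(1-\alpha)\bigr)^N\exp\bigl(-B_1N^{1/3}\bigr)\,N^{-5/6},\qquad A_1=4\pi^2\,\xi_1^{-3}\,(2\pi/C_1)^{1/2}\,\frac{qr(q+r)(q-1)(r-1)}{(r-q)^3}.$$ (ii) If $r=q$, then $$p_\alpha^{(2N)}(o,o)\sim \bar A_1\,\bigl(4\alpha(1-\alpha)\bigr)^N\exp\bigl(-B_1N^{1/3}\bigr)\,N^{1/6},\qquad \bar A_1=2(q-1)^2\,(2\pi/C_1)^{1/2}.$$ -/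

import Mathlib

open Filter Asymptotics

/-- A homogeneous tree `T_q` of degree `q + 1` on the vertex set `V`, together with a root `o` and a
reference end `ω`. The end is given by the unique geodesic ray `o = ray 0, ray 1, ray 2, …` that
starts at the root and represents `ω`. -/
structure HomTree (q : ℕ) (V : Type*) where
  graph : SimpleGraph V
  isTree : graph.IsTree
  degree_eq : ∀ x, (graph.neighborSet x).encard = ((q + 1 : ℕ) : ℕ∞)
  ray : ℕ → V
  ray_geodesic : ∀ m n, (graph.dist (ray m) (ray n) : ℤ) = |(m : ℤ) - (n : ℤ)|

namespace HomTree

variable {q : ℕ} {V : Type*} (T : HomTree q V)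

/-- The root `o`. -/
def root : V := T.ray 0

/-- `ray k` lies on the geodesic ray from `x` to the reference end `ω`: it lies on the geodesic
from `x` to `ray n` for every `n ≥ k`. -/
def OnRayFrom (x : V) (k : ℕ) : Prop :=
  ∀ n, k ≤ n → T.graph.dist x (T.ray n) = T.graph.dist x (T.ray k) + (n - k)

/-- `up x = d(o, c)`, where the confluent `c` of `x` and `o` with respect to `ω` is the first
vertex on the ray from `o` to `ω` which also lies on the ray from `x` to `ω`. -/
noncomputable def up (x : V) : ℕ := sInf {k | T.OnRayFrom x k}

/-- `dn x = d(x, c)`, where `c` is the confluent of `x` and `o` with respect to `ω`. -/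
noncomputable def dn (x : V) : ℕ := T.graph.dist x (T.ray (T.up x))

/-- The Busemann function; its level sets are the horocycles. -/
noncomputable def hor (x : V) : ℤ := (T.dn x : ℤ) - (T.up x : ℤ)

/-- `y` is the predecessor `x⁻` of `x`: the neighbour of `x` in the horocycle just before the one
of `x`. -/
def IsPred (y x : V) : Prop := T.graph.Adj x y ∧ T.hor y = T.hor x - 1

theorem hor_root : T.hor T.root = 0 := by
  have h : T.up T.root = 0 := by
    refine Nat.sInf_eq_zero.2 (Or.inl ?_)
    intro n _
    have h1 := T.ray_geodesic 0 n
    simp only [root, SimpleGraph.dist_self]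
    simp at h1
    omega
  have h2 : T.dn T.root = 0 := by
    rw [dn, h]
    exact SimpleGraph.dist_self
  simp [hor, h, h2]

end HomTree

/-- The vertex set of the Diestel-Leader graph `DL(q,r)`, the horocyclic product of `T_q` and
`T_r`. -/
def DL {q r : ℕ} {V W : Type*} (T : HomTree q V) (S : HomTree r W) : Type _ :=
  {x : V × W // T.hor x.1 + S.hor x.2 = 0}

namespace DL

variable {q r : ℕ} {V W : Type*} (T : HomTree q V) (S : HomTree r W)

/-- The reference point `o = o₁o₂`. -/
def origin : DL T S := ⟨(T.root, S.root), by simp [HomTree.hor_root]⟩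

/-- The graph structure of `DL(q,r)`: `x₁x₂ ∼ y₁y₂` iff `x₁ ∼ y₁` and `x₂ ∼ y₂`. -/
def graph : SimpleGraph (DL T S) where
  Adj x y := T.graph.Adj x.1.1 y.1.1 ∧ S.graph.Adj x.1.2 y.1.2
  symm := ⟨fun _ _ h => ⟨h.1.symm, h.2.symm⟩⟩
  loopless := ⟨fun _ h => T.graph.loopless.irrefl _ h.1⟩

variable {T S}

open Classical in
/-- The transition probabilities `p_α(x,y)` of the random walk with drift on `DL(q,r)`. -/
noncomputable def step (α : ℝ) (x y : DL T S) : ℝ :=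
  if T.IsPred x.1.1 y.1.1 ∧ S.IsPred y.1.2 x.1.2 then α / q
  else if T.IsPred y.1.1 x.1.1 ∧ S.IsPred x.1.2 y.1.2 then (1 - α) / r
  else 0

open Classical in
/-- The `n`-step transition probabilities of the walk with drift, i.e. the matrix elements of
`P_α ^ n`. -/
noncomputable def nStep (α : ℝ) : ℕ → DL T S → DL T S → ℝ
  | 0, x, y => if x = y then 1 else 0
  | n + 1, x, y => ∑' z, step α x z * nStep α n z y

/-- `ξ₁ = (2π² / log q)^{1/3}`. -/
noncomputable def xi1 (q : ℕ) : ℝ := (2 * Real.pi ^ 2 / Real.log q) ^ (1 / 3 : ℝ)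

/-- `B₁ = 3 (π log q / 2)^{2/3}`. -/
noncomputable def B1 (q : ℕ) : ℝ := 3 * (Real.pi * Real.log q / 2) ^ (2 / 3 : ℝ)

/-- `C₁ = 6 ((log q)² / (4π))^{2/3}`. -/
noncomputable def C1 (q : ℕ) : ℝ := 6 * ((Real.log q) ^ 2 / (4 * Real.pi)) ^ (2 / 3 : ℝ)

/-- The constant `A₁` of the case `r > q`. -/
noncomputable def A1 (q r : ℕ) : ℝ :=
  4 * Real.pi ^ 2 * (xi1 q ^ 3)⁻¹ * (2 * Real.pi / C1 q) ^ (1 / 2 : ℝ) *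
    ((q : ℝ) * r * (q + r) * (q - 1) * (r - 1)) / ((r : ℝ) - q) ^ 3

/-- The constant `Ā₁` of the case `r = q`. -/
noncomputable def A1bar (q : ℕ) : ℝ :=
  2 * ((q : ℝ) - 1) ^ 2 * (2 * Real.pi / C1 q) ^ (1 / 2 : ℝ)

end DL

/-! The horocycle index of the first coordinate performs a walk on ℤ that goes up with probability
`α` and down with probability `1 - α`. In each tree a move to the predecessor is forced and a move
to a successor is uniform. If the walk on ℤ makes a loop at 0 with minimum `-a` and maximum `b`, the
first coordinate has climbed to `ray a` and must come down along `a` prescribed edges; in the second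
tree `b` edges are prescribed. The walk on the graph thus closes up with probability `q⁻ᵃ r⁻ᵇ`.
Summation by parts in `a` and `b` replaces "extrema exactly `-a`, `b`" by "stays in `[-a, b]`", at
the price of the factors `1 - q⁻¹` and `1 - r⁻¹`. No trajectories are decomposed. The formula is
written for an arbitrary starting vertex (`levelTerm`), and it is checked, separately for each pair
`(a, b)`, that it obeys the one-step recursion (`levelTerm_succ`); `nStep_origin` follows by
induction.

The walk killed outside an interval is diagonalized by sines. Grouping by `k = a + b + 2` gives `∑ₖ
q⁻ᵏ spectralSum (q / r) N k`, up to explicit factors (`nStep_origin_origin`). Only the eigenvalues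
`j = 1` and `j = k - 1` matter; they contribute equally because the power is even.

What remains is Laplace's method. With `L = log q`, the exponent `-L k - π² N / k²` is maximal at `k
= ξ₁ N^(1/3)`, with value `-B₁ N^(1/3)` and second derivative `-C₁ N^(-1/3)`, so about `N^(1/6)`
values of `k` contribute (`tendsto_tsum_laplaceTerm`). The spectral weight at `j = 1` equals 1 if `r
= q`, and is of order `k⁻³`, hence `N⁻¹`, if `r > q`. This gives the exponents `1/6` and `1/6 - 1 =
-5/6`. -/

/-- In a tree, every vertex other than `z` has a unique neighbour that is closer to `z`. -/
theorem SimpleGraph.IsTree.existsUnique_adj_dist_add_one {V : Type*} {G : SimpleGraph V}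
    (hG : G.IsTree) {x z : V} (hxz : x ≠ z) :
    ∃! y, G.Adj x y ∧ G.dist y z + 1 = G.dist x z := by
  obtain ⟨p, hp⟩ := hG.connected.exists_walk_length_eq_dist x z
  cases p with
  | nil => exact absurd rfl hxz
  | @cons _ y _ hxy p =>
    have hp' : p.length = G.dist y z := by
      have h1 := SimpleGraph.dist_le p
      rw [SimpleGraph.Walk.length_cons] at hp
      have h2 := hG.dist_eq_dist_add_one_of_adj z hxy
      rw [SimpleGraph.dist_comm, SimpleGraph.dist_comm (u := z) (v := y)] at h2
      omega
    refine ⟨y, ⟨hxy, by rw [← hp, ← hp', SimpleGraph.Walk.length_cons]⟩, ?_⟩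
    rintro w ⟨hxw, hw⟩
    obtain ⟨p', hp''⟩ := hG.connected.exists_walk_length_eq_dist w z
    have e := (hG.existsUnique_path x z).unique
      (SimpleGraph.Walk.isPath_of_length_eq_dist _ hp)
      (SimpleGraph.Walk.isPath_of_length_eq_dist (.cons hxw p')
        (by rw [SimpleGraph.Walk.length_cons, hp'', hw]))
    have := congrArg SimpleGraph.Walk.snd e
    simpa using this.symm

/-! ### Confluents, horocycles and predecessors in a tree with a reference end -/

namespace HomTree

variable {q : ℕ} {V : Type*} (T : HomTree q V)

theorem dist_adj (z : V) {x y : V} (h : T.graph.Adj x y) :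
    T.graph.dist x z = T.graph.dist y z + 1 ∨ T.graph.dist y z = T.graph.dist x z + 1 := by
  have h2 := T.isTree.dist_eq_dist_add_one_of_adj z h
  simpa [SimpleGraph.dist_comm (u := z)] using h2

theorem ray_adj (k : ℕ) : T.graph.Adj (T.ray k) (T.ray (k + 1)) := by
  have h := T.ray_geodesic k (k + 1)
  simpa using h

theorem dist_ray_succ_le (x : V) (k : ℕ) :
    T.graph.dist x (T.ray (k + 1)) ≤ T.graph.dist x (T.ray k) + 1 := by
  have := T.dist_adj x (T.ray_adj k)
  simp only [SimpleGraph.dist_comm (v := x)] at this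
  omega

theorem dist_ray_sub_le (x : V) (k m : ℕ) :
    T.graph.dist x (T.ray (k + m)) ≤ T.graph.dist x (T.ray k) + m := by
  induction m with
  | zero => simp
  | succ m ih => have := T.dist_ray_succ_le x (k + m); rw [← add_assoc]; omega

theorem le_dist_ray (x : V) (k : ℕ) :
    k ≤ T.graph.dist x (T.ray k) + T.graph.dist x (T.ray 0) := by
  have h := T.isTree.connected.dist_triangle (u := T.ray 0) (v := x) (w := T.ray k)
  have h2 := T.ray_geodesic 0 k
  rw [SimpleGraph.dist_comm (u := T.ray 0) (v := x)] at h
  simp at h2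
  omega

theorem exists_onRayFrom (x : V) : ∃ k, T.OnRayFrom x k := by
  -- Minimize `d(x, ray k) - k`. Adding `d(x, ray 0)` keeps the natural subtraction from truncating,
  -- by `le_dist_ray`.
  obtain ⟨k, hk⟩ : ∃ k, ∀ n, T.graph.dist x (T.ray k) + T.graph.dist x (T.ray 0) - k ≤
      T.graph.dist x (T.ray n) + T.graph.dist x (T.ray 0) - n := by
    have := Function.argmin_le
      (fun k => T.graph.dist x (T.ray k) + T.graph.dist x (T.ray 0) - k)
    exact ⟨_, fun n => this n⟩
  refine ⟨k, fun n hn => ?_⟩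
  obtain ⟨m, rfl⟩ := Nat.exists_eq_add_of_le hn
  have h1 := hk (k + m)
  have h2 := T.dist_ray_sub_le x k m
  have h3 := T.le_dist_ray x k
  have h4 := T.le_dist_ray x (k + m)
  omega

theorem onRayFrom_up (x : V) : T.OnRayFrom x (T.up x) := Nat.sInf_mem (T.exists_onRayFrom x)

theorem dist_ray_of_up_le {x : V} {n : ℕ} (h : T.up x ≤ n) :
    (T.graph.dist x (T.ray n) : ℤ) = T.hor x + n := by
  have := T.onRayFrom_up x n h
  rw [hor, dn]
  omega

theorem hor_add_le_dist (x : V) (k : ℕ) : T.hor x + k ≤ T.graph.dist x (T.ray k) := by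
  have h1 := T.dist_ray_of_up_le (x := x) (n := k + T.up x) (by omega)
  have h2 := T.dist_ray_sub_le x k (T.up x)
  push_cast at h1
  omega

theorem onRayFrom_iff (x : V) (k : ℕ) :
    T.OnRayFrom x k ↔ (T.graph.dist x (T.ray k) : ℤ) = T.hor x + k := by
  constructor
  · intro h
    have h1 := T.dist_ray_of_up_le (x := x) (n := k + T.up x) (by omega)
    have h2 := h (k + T.up x) (by omega)
    push_cast at h1
    omega
  · intro h n hn
    obtain ⟨m, rfl⟩ := Nat.exists_eq_add_of_le hn
    have h1 := T.hor_add_le_dist x (k + m)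
    have h2 := T.dist_ray_sub_le x k m
    push_cast at h1
    omega

/-- In general only `≥` holds between the two sides of the equation (`hor_add_le_dist`); equality
characterizes the ray vertices at or beyond the confluent. This turns statements about confluents
into linear arithmetic of distances. -/
theorem up_le_iff (x : V) (k : ℕ) :
    T.up x ≤ k ↔ (T.graph.dist x (T.ray k) : ℤ) = T.hor x + k := by
  refine ⟨fun h => T.dist_ray_of_up_le h, fun h => Nat.sInf_le ((T.onRayFrom_iff x k).2 h)⟩

theorem hor_eq_or_of_adj {x y : V} (h : T.graph.Adj x y) :
    T.hor y = T.hor x - 1 ∨ T.hor y = T.hor x + 1 := by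
  have h1 := T.dist_ray_of_up_le (x := x) (n := T.up x + T.up y) (by omega)
  have h2 := T.dist_ray_of_up_le (x := y) (n := T.up x + T.up y) (by omega)
  have h3 := T.dist_adj (T.ray (T.up x + T.up y)) h
  omega

/-- Since `x` has finitely many neighbours, some `ray n` lies beyond all confluents involved. There
the horocycle index and the distance to `ray n` differ by a constant, so predecessors are the
neighbours closer to `ray n`. -/
theorem existsUnique_isPred (x : V) : ∃! y, T.IsPred y x := by
  have hfin : (T.graph.neighborSet x).Finite := by
    rw [← Set.encard_ne_top_iff, T.degree_eq x]
    exact ENat.natCast_ne_top _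
  obtain ⟨B, hB⟩ := (hfin.image T.up).bddAbove
  have hB' : ∀ y, T.graph.Adj x y → T.up y ≤ B := fun y hy => hB ⟨y, hy, rfl⟩
  set n := B + T.up x + 1 with hn
  have hx := T.dist_ray_of_up_le (x := x) (n := n) (by omega)
  have hne : x ≠ T.ray n := by
    intro h
    rw [← h, SimpleGraph.dist_self, hor] at hx
    push_cast at hx
    omega
  obtain ⟨y, ⟨hy, hd⟩, huniq⟩ := T.isTree.existsUnique_adj_dist_add_one hne
  have key : ∀ y, T.graph.Adj x y → (T.graph.dist y (T.ray n) : ℤ) = T.hor y + n := fun y hy =>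
    T.dist_ray_of_up_le (by have := hB' y hy; omega)
  refine ⟨y, ⟨hy, ?_⟩, fun w hw => huniq w ⟨hw.1, ?_⟩⟩
  · have := key y hy; omega
  · have := key w hw.1; have := hw.2; omega

/-- The predecessor of a vertex. -/
noncomputable def pred (x : V) : V := (T.existsUnique_isPred x).choose

theorem isPred_pred (x : V) : T.IsPred (T.pred x) x := (T.existsUnique_isPred x).choose_spec.1

theorem isPred_iff {x y : V} : T.IsPred y x ↔ y = T.pred x :=
  ⟨fun h => (T.existsUnique_isPred x).unique h (T.isPred_pred x), fun h => h ▸ T.isPred_pred x⟩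

theorem hor_pred (x : V) : T.hor (T.pred x) = T.hor x - 1 := (T.isPred_pred x).2

/-- The set of successors of a vertex. -/
def children (x : V) : Set V := {y | T.IsPred x y}

theorem children_encard (x : V) : (T.children x).encard = q := by
  have h : T.graph.neighborSet x = insert (T.pred x) (T.children x) := by
    ext y
    simp only [SimpleGraph.mem_neighborSet, Set.mem_insert_iff, children, Set.mem_ofPred_eq]
    constructor
    · intro h
      rcases T.hor_eq_or_of_adj h with h1 | h1
      · exact Or.inl (T.isPred_iff.1 ⟨h, h1⟩)
      · exact Or.inr ⟨h.symm, by omega⟩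
    · rintro (rfl | h)
      · exact (T.isPred_pred x).1
      · exact h.1.symm
  have h2 : T.pred x ∉ T.children x := by
    intro h
    have h1 := T.hor_pred x
    have := h.2
    omega
  have h3 := T.degree_eq x
  rw [h, Set.encard_insert_of_notMem h2] at h3
  push_cast at h3
  exact ENat.add_left_injective_of_ne_top ENat.one_ne_top h3

theorem children_finite (x : V) : (T.children x).Finite := by
  rw [← Set.encard_ne_top_iff, T.children_encard x]
  exact ENat.natCast_ne_top _

/-- The successors of a vertex, as a finite set. -/
noncomputable def succs (x : V) : Finset V := (T.children_finite x).toFinset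

theorem mem_succs {x y : V} : y ∈ T.succs x ↔ T.IsPred x y := by simp [succs, children]

theorem card_succs (x : V) : (T.succs x).card = q := by
  have := T.children_encard x
  rw [(T.children_finite x).encard_eq_coe_toFinset_card] at this
  exact_mod_cast this

theorem hor_ray (k : ℕ) : T.hor (T.ray k) = -k := by
  have h := T.dist_ray_of_up_le (x := T.ray k) (n := k + T.up (T.ray k)) (by omega)
  have h2 := T.ray_geodesic k (k + T.up (T.ray k))
  rw [abs_of_nonpos (by push_cast; omega)] at h2
  push_cast at h h2
  omega

theorem up_ray (k : ℕ) : T.up (T.ray k) = k := by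
  apply le_antisymm
  · rw [up_le_iff, SimpleGraph.dist_self, hor_ray]; simp
  · have h := T.dist_ray_of_up_le (x := T.ray k) le_rfl
    rw [hor_ray] at h
    omega

theorem eq_ray_of_hor {x : V} (h : T.hor x = -T.up x) : x = T.ray (T.up x) := by
  rw [hor] at h
  have h1 : T.graph.dist x (T.ray (T.up x)) = 0 := by rw [← dn]; omega
  exact T.isTree.connected.dist_eq_zero_iff.1 h1

theorem neg_up_le_hor (x : V) : -(T.up x : ℤ) ≤ T.hor x := by rw [hor]; omega

/-- A vertex and its predecessor have the same confluent with the root, unless both are on the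
ray from the root to the reference end. -/
theorem up_eq_of_isPred {x y : V} (h : T.IsPred x y) :
    T.up y = T.up x ∨ ∃ k, x = T.ray (k + 1) ∧ y = T.ray k := by
  by_cases hex : ∃ k, x = T.ray (k + 1) ∧ y = T.ray k
  · exact Or.inr hex
  left
  have hh := h.2
  apply le_antisymm
  · rw [up_le_iff]
    have h1 := T.dist_ray_of_up_le (x := x) le_rfl
    have h2 := T.hor_add_le_dist y (T.up x)
    have h3 := T.dist_adj (T.ray (T.up x)) h.1
    omega
  · have key : ∀ m, (T.graph.dist x (T.ray (T.up y + m)) : ℤ) = T.hor x + (T.up y + m : ℕ) := by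
      by_contra! hcon
      obtain ⟨m, hm⟩ := hcon
      -- If the equality fails at one ray vertex beyond the confluent of `y`, it fails at all later
      -- ones, which is absurd beyond the confluent of `x`.
      have claim : ∀ i, (T.graph.dist x (T.ray (T.up y + m + i)) : ℤ) ≠
          T.hor x + (T.up y + m + i : ℕ) := by
        intro i
        induction i with
        | zero => simpa using hm
        | succ i ih =>
          intro hi
          set k := T.up y + m + i with hk
          rw [← add_assoc, ← hk] at hi
          have a1 := T.dist_ray_of_up_le (x := y) (n := k) (by omega)
          have a2 := T.dist_ray_of_up_le (x := y) (n := k + 1) (by omega)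
          have a3 := T.dist_adj (T.ray k) h.1
          apply hex
          by_cases hD : T.graph.dist y (T.ray k) = 0
          · refine ⟨k, ?_, T.isTree.connected.dist_eq_zero_iff.1 hD⟩
            apply T.isTree.connected.dist_eq_zero_iff.1
            push_cast at hi a2
            omega
          · exfalso
            have hxk1 : x ≠ T.ray (k + 1) := by
              intro e
              have : T.graph.dist x (T.ray (k + 1)) = 0 := by rw [← e]; simp
              push_cast at hi a2
              omega
            -- With `D = d(y, ray k)`, here `d(x, ray k) = D + 1` and `d(x, ray (k+1)) = D`. The
            -- neighbour of `x` closer to `ray (k+1)` is then also closer to `ray k`, so it is `y`;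
            -- but `d(y, ray (k+1)) = D + 1`.
            have hxk : x ≠ T.ray k := by
              intro e
              have : T.graph.dist x (T.ray k) = 0 := by rw [← e]; simp
              push_cast at hi a2
              omega
            obtain ⟨z, ⟨hz, hz1⟩, -⟩ := T.isTree.existsUnique_adj_dist_add_one hxk1
            obtain ⟨w, -, hw⟩ := T.isTree.existsUnique_adj_dist_add_one hxk
            have e1 := hw y ⟨h.1.symm, by push_cast at hi a2; omega⟩
            have e2 := hw z ⟨hz, by
              have b1 := T.dist_adj (T.ray k) hz
              have b2 := T.dist_adj z (T.ray_adj k)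
              simp only [SimpleGraph.dist_comm (v := z)] at b2
              push_cast at hi a2
              omega⟩
            rw [e2, ← e1] at hz1
            push_cast at hi a2
            omega
      have h1 := T.dist_ray_of_up_le (x := x) (n := T.up y + m + T.up x) (by omega)
      exact claim _ h1
    rw [up_le_iff]
    simpa using key 0

end HomTree

/-! ### The kernel of the simple random walk killed outside an interval -/

theorem two_mul_sin_half_mul_sum_cos (θ : ℝ) (k : ℕ) :
    2 * Real.sin (θ / 2) * ∑ j ∈ Finset.range k, Real.cos (j * θ) =
      Real.sin (k * θ - θ / 2) + Real.sin (θ / 2) := by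
  induction k with
  | zero => simp
  | succ k ih =>
    rw [Finset.sum_range_succ, mul_add, ih]
    push_cast
    have h1 : ((k : ℝ) + 1) * θ - θ / 2 = k * θ + θ / 2 := by ring
    rw [h1, Real.sin_add, Real.sin_sub]
    ring

/-- The Dirichlet kernel at `θ = π m / k`. The restriction `0 < |m| < 2k` is what makes the
denominator `sin (θ / 2)` nonzero. -/
theorem sum_cos_pi_mul_div {k : ℕ} {m : ℤ} (h0 : m ≠ 0) (h1 : -(2 * k : ℤ) < m)
    (h2 : m < 2 * k) :
    ∑ j ∈ Finset.range k, Real.cos (j * (Real.pi * m / k)) = (1 - (-1) ^ m) / 2 := by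
  have hk : (0 : ℝ) < k := by
    have : 0 < k := by omega
    exact_mod_cast this
  have h := two_mul_sin_half_mul_sum_cos (Real.pi * m / k) k
  have e : (k : ℝ) * (Real.pi * m / k) - Real.pi * m / k / 2 =
      m * Real.pi - Real.pi * m / k / 2 := by field_simp
  rw [e, Real.sin_sub, Real.sin_int_mul_pi, Real.cos_int_mul_pi] at h
  have hs : Real.sin (Real.pi * m / k / 2) ≠ 0 := by
    intro hs
    rw [Real.sin_eq_zero_iff] at hs
    obtain ⟨n, hn⟩ := hs
    have hm : (m : ℝ) = ((n * (2 * k) : ℤ) : ℝ) := by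
      push_cast
      field_simp at hn
      linarith
    have hm' : m = n * (2 * k) := by exact_mod_cast hm
    have hn1 : n < 1 := by
      by_contra hcon
      nlinarith
    have hn2 : -1 < n := by
      by_contra hcon
      nlinarith
    have : n = 0 := by omega
    simp [this] at hm'
    exact h0 hm'
  have := mul_left_cancel₀ hs (b := 2 * ∑ j ∈ Finset.range k, Real.cos (j * (Real.pi * m / k)))
    (c := 1 - (-1) ^ m) (by linarith)
  linarith

/-- The number of walks of length `n` from `u` to `v` in the path `{1, …, k - 1}`, in its spectral
form. -/
noncomputable def pathKernel (k n : ℕ) (u v : ℤ) : ℝ :=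
  2 / k * ∑ j ∈ Finset.range k, Real.sin (j * (Real.pi * u / k)) *
    Real.sin (j * (Real.pi * v / k)) * (2 * Real.cos (j * (Real.pi / k))) ^ n

theorem pathKernel_zero_left (k n : ℕ) (v : ℤ) : pathKernel k n 0 v = 0 := by
  simp [pathKernel]

theorem pathKernel_self_left (k n : ℕ) (v : ℤ) : pathKernel k n k v = 0 := by
  rcases Nat.eq_zero_or_pos k with rfl | hk
  · simp [pathKernel]
  · have hk' : (k : ℝ) ≠ 0 := by positivity
    rw [pathKernel, Finset.sum_eq_zero, mul_zero]
    intro j _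
    have : (j : ℝ) * (Real.pi * (k : ℤ) / k) = j * Real.pi := by push_cast; field_simp
    rw [this, Real.sin_nat_mul_pi, zero_mul, zero_mul]

theorem pathKernel_succ (k n : ℕ) (u v : ℤ) :
    pathKernel k (n + 1) u v = pathKernel k n (u + 1) v + pathKernel k n (u - 1) v := by
  rw [pathKernel, pathKernel, pathKernel, ← mul_add, ← Finset.sum_add_distrib]
  congr 1
  refine Finset.sum_congr rfl fun j _ => ?_
  have h1 : (j : ℝ) * (Real.pi * ((u + 1 : ℤ) : ℝ) / k) =
    j * (Real.pi * u / k) + j * (Real.pi / k) := by push_cast; ring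
  have h2 : (j : ℝ) * (Real.pi * ((u - 1 : ℤ) : ℝ) / k) =
    j * (Real.pi * u / k) - j * (Real.pi / k) := by push_cast; ring
  rw [h1, h2, Real.sin_add, Real.sin_sub]
  ring

theorem pathKernel_zero {k : ℕ} {u v : ℤ} (hu0 : 0 < u) (hu : u < k) (hv0 : 0 < v) (hv : v < k) :
    pathKernel k 0 u v = if u = v then 1 else 0 := by
  have hk : (0 : ℝ) < k := by
    have : 0 < k := by omega
    exact_mod_cast this
  have h : ∀ j ∈ Finset.range k, Real.sin (j * (Real.pi * u / k)) *
      Real.sin (j * (Real.pi * v / k)) * (2 * Real.cos (j * (Real.pi / k))) ^ 0 =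
      (Real.cos (j * (Real.pi * (u - v : ℤ) / k)) -
        Real.cos (j * (Real.pi * (u + v : ℤ) / k))) / 2 := by
    intro j _
    have h1 : (j : ℝ) * (Real.pi * ((u - v : ℤ) : ℝ) / k) =
      j * (Real.pi * u / k) - j * (Real.pi * v / k) := by push_cast; ring
    have h2 : (j : ℝ) * (Real.pi * ((u + v : ℤ) : ℝ) / k) =
      j * (Real.pi * u / k) + j * (Real.pi * v / k) := by push_cast; ring
    rw [h1, h2, Real.cos_add, Real.cos_sub]
    ring
  rw [pathKernel, Finset.sum_congr rfl h, ← Finset.sum_div, Finset.sum_sub_distrib,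
    sum_cos_pi_mul_div (m := u + v) (by omega) (by omega) (by omega)]
  split_ifs with huv
  · subst huv
    have : (-1 : ℝ) ^ (u + u) = 1 := Even.neg_one_zpow ⟨u, rfl⟩
    rw [this]
    simp
    omega
  · rw [sum_cos_pi_mul_div (m := u - v) (by omega) (by omega) (by omega)]
    -- `u + v` and `u - v` have the same parity, so the two cosine sums cancel.
    have : (-1 : ℝ) ^ (u + v) = (-1) ^ (u - v) := by
      have : u + v = (u - v) + 2 * v := by ring
      rw [this, zpow_add₀ (by norm_num), zpow_mul]
      simp
    rw [this]
    simp

theorem abs_pathKernel_le (k n : ℕ) (u v : ℤ) : |pathKernel k n u v| ≤ 2 * 2 ^ n := by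
  rcases Nat.eq_zero_or_pos k with rfl | hk
  · simp [pathKernel]
  · have hk' : (0 : ℝ) < k := by exact_mod_cast hk
    rw [pathKernel, abs_mul, abs_of_pos (by positivity : (0 : ℝ) < 2 / k)]
    have : |∑ j ∈ Finset.range k, Real.sin (j * (Real.pi * u / k)) *
        Real.sin (j * (Real.pi * v / k)) * (2 * Real.cos (j * (Real.pi / k))) ^ n| ≤
        k * 2 ^ n := by
      refine (Finset.abs_sum_le_sum_abs _ _).trans ?_
      refine (Finset.sum_le_card_nsmul _ _ (2 ^ n) fun j _ => ?_).trans (by simp)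
      rw [abs_mul, abs_mul, abs_pow, abs_mul, abs_two]
      have h1 := Real.abs_sin_le_one (j * (Real.pi * u / k))
      have h2 := Real.abs_sin_le_one (j * (Real.pi * v / k))
      have h3 := Real.abs_cos_le_one (j * (Real.pi / k))
      calc _ ≤ 1 * 1 * (2 * 1 : ℝ) ^ n := by gcongr
        _ = 2 ^ n := by simp
    calc _ ≤ 2 / (k : ℝ) * (k * 2 ^ n) := by gcongr
      _ = 2 * 2 ^ n := by field_simp

/-- The weight of all `n`-step paths in `ℤ` from `t` to `0` that stay in `[-a, b]`, where an
up-step has weight `α` and a down-step has weight `1 - α`. -/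
noncomputable def killedKernel (α : ℝ) (a b n : ℕ) (t : ℤ) : ℝ :=
  if -(a : ℤ) ≤ t ∧ t ≤ b then
    √(α / (1 - α)) ^ (-t) * √(α * (1 - α)) ^ n * pathKernel (a + b + 2) n (t + a + 1) (a + 1)
  else 0

section killedKernel

variable {α : ℝ}

theorem killedKernel_of_lt {a b n : ℕ} {t : ℤ} (h : t < -(a : ℤ)) :
    killedKernel α a b n t = 0 := if_neg (by omega)

theorem killedKernel_of_gt {a b n : ℕ} {t : ℤ} (h : (b : ℤ) < t) :
    killedKernel α a b n t = 0 := if_neg (by omega)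

/-- The sine formula vanishes at the endpoints `0` and `k` of the path, so it stays valid one site
beyond the interval on either side. The recursion therefore needs no boundary cases. -/
theorem killedKernel_eq {a b n : ℕ} {t : ℤ} (h1 : -(a : ℤ) - 1 ≤ t) (h2 : t ≤ b + 1) :
    killedKernel α a b n t = √(α / (1 - α)) ^ (-t) * √(α * (1 - α)) ^ n *
      pathKernel (a + b + 2) n (t + a + 1) (a + 1) := by
  by_cases h : -(a : ℤ) ≤ t ∧ t ≤ b
  · exact if_pos h
  · rw [killedKernel, if_neg h]
    rcases eq_or_lt_of_le h1 with h3 | h3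
    · have : t + a + 1 = 0 := by omega
      rw [this, pathKernel_zero_left, mul_zero]
    · have : t + a + 1 = ((a + b + 2 : ℕ) : ℤ) := by push_cast; omega
      rw [this, pathKernel_self_left, mul_zero]

theorem killedKernel_succ (hα0 : 0 < α) (hα1 : α < 1) {a b n : ℕ} {t : ℤ} (h1 : -(a : ℤ) ≤ t)
    (h2 : t ≤ b) : killedKernel α a b (n + 1) t =
      α * killedKernel α a b n (t + 1) + (1 - α) * killedKernel α a b n (t - 1) := by
  have hβ : 0 < 1 - α := by linarith
  rw [killedKernel_eq (by omega) (by omega), killedKernel_eq (by omega) (by omega),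
    killedKernel_eq (by omega) (by omega), pathKernel_succ]
  have e1 : t + 1 + (a : ℤ) + 1 = t + a + 1 + 1 := by ring
  have e2 : t - 1 + (a : ℤ) + 1 = t + a + 1 - 1 := by ring
  rw [e1, e2, show -(t + 1) = -t + -1 by ring, show -(t - 1) = -t + 1 by ring, pow_succ]
  have hρ : √(α / (1 - α)) ≠ 0 := by positivity
  rw [zpow_add₀ hρ, zpow_add₀ hρ, zpow_neg_one, zpow_one]
  have s1 : α * (√(α / (1 - α)))⁻¹ = √(α * (1 - α)) := by
    rw [Real.sqrt_div hα0.le, Real.sqrt_mul hα0.le, inv_div]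
    field_simp
    rw [Real.sq_sqrt hα0.le]
  have s2 : (1 - α) * √(α / (1 - α)) = √(α * (1 - α)) := by
    rw [Real.sqrt_div hα0.le, Real.sqrt_mul hα0.le]
    field_simp
    rw [Real.sq_sqrt hβ.le]
  calc _ = √(α / (1 - α)) ^ (-t) * √(α * (1 - α)) ^ n * (√(α * (1 - α)) *
        pathKernel (a + b + 2) n (t + a + 1 + 1) (a + 1) + √(α * (1 - α)) *
        pathKernel (a + b + 2) n (t + a + 1 - 1) (a + 1)) := by ring
    _ = √(α / (1 - α)) ^ (-t) * √(α * (1 - α)) ^ n * (α * (√(α / (1 - α)))⁻¹ *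
        pathKernel (a + b + 2) n (t + a + 1 + 1) (a + 1) + (1 - α) * √(α / (1 - α)) *
        pathKernel (a + b + 2) n (t + a + 1 - 1) (a + 1)) := by rw [s1, s2]
    _ = _ := by ring

theorem killedKernel_zero {a b : ℕ} {t : ℤ} :
    killedKernel α a b 0 t = if t = 0 then 1 else 0 := by
  by_cases h : -(a : ℤ) ≤ t ∧ t ≤ b
  · rw [killedKernel, if_pos h, pathKernel_zero (by omega) (by omega) (by omega) (by omega)]
    by_cases ht : t = 0
    · simp [ht]
    · rw [if_neg (by omega), if_neg ht, mul_zero]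
  · rw [killedKernel, if_neg h, if_neg (by omega)]

theorem abs_killedKernel_le (a b n : ℕ) (t : ℤ) : |killedKernel α a b n t| ≤
    √(α / (1 - α)) ^ (-t) * √(α * (1 - α)) ^ n * (2 * 2 ^ n) := by
  rw [killedKernel]
  split_ifs
  · rw [abs_mul, abs_of_nonneg (by positivity)]
    gcongr
    exact abs_pathKernel_le _ _ _ _
  · rw [abs_zero]
    positivity

end killedKernel

/-! ### Weights on the tree -/

/-- The difference `g a - g (a + 1)` for `g a = q ^ (-a)` if `u ≤ a` and `g a = 0` otherwise. -/
noncomputable def levelWeight (q a u : ℕ) : ℝ :=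
  if u ≤ a then (q : ℝ)⁻¹ ^ a * (1 - (q : ℝ)⁻¹) else if u = a + 1 then -(q : ℝ)⁻¹ ^ (a + 1) else 0

theorem levelWeight_eq_sub (q a u : ℕ) : levelWeight q a u =
    (if u ≤ a then (q : ℝ)⁻¹ ^ a else 0) - (if u ≤ a + 1 then (q : ℝ)⁻¹ ^ (a + 1) else 0) := by
  rw [levelWeight]
  by_cases h1 : u ≤ a
  · rw [if_pos h1, if_pos h1, if_pos (by omega)]; ring
  · rw [if_neg h1, if_neg h1]
    by_cases h2 : u = a + 1
    · rw [if_pos h2, if_pos (by omega)]; ring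
    · rw [if_neg h2, if_neg (by omega)]; ring

section levelWeight

variable {q : ℕ} (hq : 2 ≤ q)
include hq

theorem inv_natCast_le_half : (q : ℝ)⁻¹ ≤ 1 / 2 := by
  rw [← one_div]
  exact one_div_le_one_div_of_le (by norm_num) (by exact_mod_cast hq)

theorem abs_levelWeight_le (a u : ℕ) : |levelWeight q a u| ≤ (q : ℝ)⁻¹ ^ a := by
  have h1 := inv_natCast_le_half hq
  have h0 : (0 : ℝ) ≤ (q : ℝ)⁻¹ := by positivity
  have h2 : (0 : ℝ) ≤ (q : ℝ)⁻¹ ^ a := by positivity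
  rw [levelWeight]
  split_ifs
  · rw [abs_of_nonneg (mul_nonneg h2 (by linarith))]
    exact mul_le_of_le_one_right h2 (by linarith)
  · rw [abs_neg, abs_of_nonneg (by positivity), pow_succ]
    exact mul_le_of_le_one_right h2 (by linarith)
  · simp

theorem summable_inv_pow : Summable fun a : ℕ => (q : ℝ)⁻¹ ^ a :=
  summable_geometric_of_lt_one (by positivity) (by linarith [inv_natCast_le_half hq])

theorem hasSum_levelWeight (u : ℕ) :
    HasSum (fun a => levelWeight q a u) (if u = 0 then 1 else 0) := by
  have hs : Summable fun a => levelWeight q a u :=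
    Summable.of_norm_bounded (summable_inv_pow hq) (fun a => abs_levelWeight_le hq a u)
  rw [hs.hasSum_iff_tendsto_nat]
  have h : ∀ n, ∑ a ∈ Finset.range n, levelWeight q a u =
      (if u = 0 then 1 else 0) - (if u ≤ n then (q : ℝ)⁻¹ ^ n else 0) := by
    intro n
    simp_rw [levelWeight_eq_sub]
    rw [Finset.sum_range_sub' (fun a => if u ≤ a then (q : ℝ)⁻¹ ^ a else 0)]
    simp
  simp_rw [h]
  have h2 : Tendsto (fun n : ℕ => if u ≤ n then (q : ℝ)⁻¹ ^ n else 0) atTop (nhds 0) := by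
    refine squeeze_zero (fun n => ?_) (fun n => ?_) (summable_inv_pow hq).tendsto_atTop_zero
    · split_ifs <;> positivity
    · split_ifs
      · exact le_rfl
      · positivity
  simpa using h2.const_sub (if u = 0 then (1 : ℝ) else 0)

end levelWeight

namespace HomTree

variable {q : ℕ} {V : Type*} (T : HomTree q V)

/-- The confluent changes only along the ray to the end, and on that ray both indices are at most
`a`, where the weight does not depend on the index. -/
theorem levelWeight_up_eq {a : ℕ} {x y : V} (h : T.IsPred x y) (hx : -(a : ℤ) ≤ T.hor x) :
    levelWeight q a (T.up y) = levelWeight q a (T.up x) := by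
  rcases T.up_eq_of_isPred h with h1 | ⟨k, rfl, rfl⟩
  · rw [h1]
  · rw [T.hor_ray] at hx
    rw [T.up_ray, T.up_ray, levelWeight, levelWeight, if_pos (by omega), if_pos (by omega)]

/-- This is the boundary condition just below level `-a`. If the vertex is `ray (a+1)`, its
successor `ray a` has weight `q⁻ᵃ(1 - q⁻¹)` and the other `q - 1` successors have weight `-q⁻ᵃ⁻¹`.
Otherwise every successor has weight 0. -/
theorem sum_levelWeight_succs (hq : 2 ≤ q) {a : ℕ} {x : V} (hx : T.hor x = -(a : ℤ) - 1) :
    ∑ y ∈ T.succs x, levelWeight q a (T.up y) = 0 := by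
  classical
  have h0 := T.neg_up_le_hor x
  by_cases h : T.up x = a + 1
  · have hxr : x = T.ray (a + 1) := by
      rw [← h]
      exact T.eq_ray_of_hor (by rw [h]; push_cast; omega)
    have hmem : T.ray a ∈ T.succs x := by
      rw [T.mem_succs, hxr]
      exact ⟨T.ray_adj a, by rw [T.hor_ray, T.hor_ray]; push_cast; ring⟩
    have hrest : ∀ y ∈ (T.succs x).erase (T.ray a),
        levelWeight q a (T.up y) = -(q : ℝ)⁻¹ ^ (a + 1) := by
      intro y hy
      rw [Finset.mem_erase, T.mem_succs] at hy
      rcases T.up_eq_of_isPred hy.2 with h1 | ⟨k, h2, h3⟩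
      · rw [h1, h, levelWeight, if_neg (by omega), if_pos rfl]
      · exfalso
        have h4 := congrArg T.up h2
        rw [h, T.up_ray] at h4
        have : k = a := by omega
        exact hy.1 (this ▸ h3)
    rw [← Finset.add_sum_erase _ _ hmem, Finset.sum_congr rfl hrest, Finset.sum_const,
      Finset.card_erase_of_mem hmem, T.card_succs, T.up_ray, levelWeight, if_pos le_rfl,
      nsmul_eq_mul, Nat.cast_sub (by omega), pow_succ]
    have : (q : ℝ) ≠ 0 := by
      have : q ≠ 0 := by omega
      exact_mod_cast this
    push_cast
    field_simp
    ring
  · refine Finset.sum_eq_zero fun y hy => ?_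
    rw [T.mem_succs] at hy
    rcases T.up_eq_of_isPred hy with h1 | ⟨k, h2, -⟩
    · rw [h1, levelWeight, if_neg (by omega), if_neg h]
    · exfalso
      rw [h2, T.up_ray] at h
      rw [h2, T.hor_ray] at hx
      push_cast at hx
      omega

end HomTree

/-! ### The transition probabilities of the walk -/

namespace DL

variable {q r : ℕ} {V W : Type*} {T : HomTree q V} {S : HomTree r W}

theorem hasSum_step_mul (α : ℝ) (x : DL T S) (F : V → W → ℝ) :
    HasSum (fun z : DL T S => step α x z * F z.1.1 z.1.2)
      (α / q * ∑ y ∈ T.succs x.1.1, F y (S.pred x.1.2) +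
        (1 - α) / r * ∑ y ∈ S.succs x.1.2, F (T.pred x.1.1) y) := by
  classical
  set g₁ : V × W → ℝ := fun p =>
    if p ∈ T.succs x.1.1 ×ˢ {S.pred x.1.2} then α / q * F p.1 p.2 else 0 with hg₁
  set g₂ : V × W → ℝ := fun p =>
    if p ∈ {T.pred x.1.1} ×ˢ S.succs x.1.2 then (1 - α) / r * F p.1 p.2 else 0 with hg₂
  have hx := x.2
  have hstep : ∀ z : DL T S, step α x z * F z.1.1 z.1.2 = g₁ z.1 + g₂ z.1 := by
    intro z
    have e1 : (T.IsPred x.1.1 z.1.1 ∧ S.IsPred z.1.2 x.1.2) ↔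
        z.1 ∈ T.succs x.1.1 ×ˢ {S.pred x.1.2} := by
      rw [Finset.mem_product, T.mem_succs, Finset.mem_singleton, S.isPred_iff]
    have e2 : (T.IsPred z.1.1 x.1.1 ∧ S.IsPred x.1.2 z.1.2) ↔
        z.1 ∈ ({T.pred x.1.1} : Finset V) ×ˢ S.succs x.1.2 := by
      rw [Finset.mem_product, S.mem_succs, Finset.mem_singleton, T.isPred_iff]
    simp only [step, hg₁, hg₂, ← e1, ← e2]
    by_cases h1 : T.IsPred x.1.1 z.1.1 ∧ S.IsPred z.1.2 x.1.2
    · have h2 : ¬ (T.IsPred z.1.1 x.1.1 ∧ S.IsPred x.1.2 z.1.2) := by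
        intro h2
        have := h1.1.2
        have := h2.1.2
        omega
      simp [h1, h2]
    · by_cases h2 : T.IsPred z.1.1 x.1.1 ∧ S.IsPred x.1.2 z.1.2 <;> simp [h1, h2]
  simp_rw [hstep]
  refine HasSum.add ?_ ?_
  · refine (hasSum_subtype_iff_of_support_subset (s := {p : V × W | T.hor p.1 + S.hor p.2 = 0})
      (f := g₁) ?_).2 ?_
    · intro p hp
      rw [Function.mem_support] at hp
      have hp' : p ∈ T.succs x.1.1 ×ˢ {S.pred x.1.2} := by
        by_contra hcon
        exact hp (if_neg hcon)
      rw [Finset.mem_product, T.mem_succs, Finset.mem_singleton] at hp'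
      have h1 := hp'.1.2
      have h2 := S.hor_pred x.1.2
      show T.hor p.1 + S.hor p.2 = 0
      rw [hp'.2]
      omega
    · have := hasSum_sum_of_ne_finset_zero (L := .unconditional _) (f := g₁) (s := T.succs x.1.1 ×ˢ {S.pred x.1.2})
        (fun p hp => if_neg hp)
      rwa [Finset.sum_congr rfl (fun p hp => if_pos hp), Finset.sum_product,
        Finset.sum_congr rfl (fun y _ => Finset.sum_singleton _ _), ← Finset.mul_sum] at this
  · refine (hasSum_subtype_iff_of_support_subset (s := {p : V × W | T.hor p.1 + S.hor p.2 = 0})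
      (f := g₂) ?_).2 ?_
    · intro p hp
      rw [Function.mem_support] at hp
      have hp' : p ∈ ({T.pred x.1.1} : Finset V) ×ˢ S.succs x.1.2 := by
        by_contra hcon
        exact hp (if_neg hcon)
      rw [Finset.mem_product, S.mem_succs, Finset.mem_singleton] at hp'
      have h1 := hp'.2.2
      have h2 := T.hor_pred x.1.1
      show T.hor p.1 + S.hor p.2 = 0
      rw [hp'.1]
      omega
    · have := hasSum_sum_of_ne_finset_zero (L := .unconditional _) (f := g₂)
        (s := ({T.pred x.1.1} : Finset V) ×ˢ S.succs x.1.2) (fun p hp => if_neg hp)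
      rwa [Finset.sum_congr rfl (fun p hp => if_pos hp), Finset.sum_product,
        Finset.sum_singleton, ← Finset.mul_sum] at this

/-- The contribution of the pair of levels `p` to the `n`-step transition probability to the
origin. -/
noncomputable def levelTerm (T : HomTree q V) (S : HomTree r W) (α : ℝ) (n : ℕ) (v : V) (w : W)
    (p : ℕ × ℕ) : ℝ :=
  levelWeight q p.1 (T.up v) * levelWeight r p.2 (S.up w) * killedKernel α p.1 p.2 n (T.hor v)

theorem summable_levelTerm (hq : 2 ≤ q) (hr : 2 ≤ r) (α : ℝ) (n : ℕ) (v : V) (w : W) :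
    Summable (levelTerm T S α n v w) := by
  have h := ((summable_inv_pow hq).mul_of_nonneg (summable_inv_pow hr)
    (fun a => by positivity) (fun a => by positivity)).mul_right
    (√(α / (1 - α)) ^ (-T.hor v) * √(α * (1 - α)) ^ n * (2 * 2 ^ n))
  refine Summable.of_norm_bounded h fun p => ?_
  rw [levelTerm, Real.norm_eq_abs, abs_mul, abs_mul]
  gcongr
  · exact abs_levelWeight_le hq _ _
  · exact abs_levelWeight_le hr _ _
  · exact abs_killedKernel_le _ _ _ _

/-- Inside the strip `-a ≤ hor ≤ b` the tree weights are constant along relevant edges, and the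
kernel recursion applies. Outside it the right side is 0, and the only possible incoming
contribution is from the adjacent boundary level, where the successor weights sum to 0. -/
theorem levelTerm_succ (hq : 2 ≤ q) (hr : 2 ≤ r) {α : ℝ} (hα0 : 0 < α) (hα1 : α < 1) (n : ℕ)
    (x : DL T S) (p : ℕ × ℕ) :
    α / q * ∑ y ∈ T.succs x.1.1, levelTerm T S α n y (S.pred x.1.2) p +
      (1 - α) / r * ∑ y ∈ S.succs x.1.2, levelTerm T S α n (T.pred x.1.1) y p =
    levelTerm T S α (n + 1) x.1.1 x.1.2 p := by
  obtain ⟨a, b⟩ := p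
  obtain ⟨⟨v, w⟩, hvw⟩ := x
  have hq' : (q : ℝ) ≠ 0 := by
    have : q ≠ 0 := by omega
    exact_mod_cast this
  have hr' : (r : ℝ) ≠ 0 := by
    have : r ≠ 0 := by omega
    exact_mod_cast this
  simp only at hvw ⊢
  have hw : S.hor w = -T.hor v := by omega
  have e1 : ∑ y ∈ T.succs v, levelTerm T S α n y (S.pred w) (a, b) =
      (∑ y ∈ T.succs v, levelWeight q a (T.up y)) * (levelWeight r b (S.up (S.pred w)) *
        killedKernel α a b n (T.hor v + 1)) := by
    rw [Finset.sum_mul]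
    refine Finset.sum_congr rfl fun y hy => ?_
    have := ((T.mem_succs).1 hy).2
    rw [levelTerm, show T.hor y = T.hor v + 1 by omega, mul_assoc]
  have e2 : ∑ y ∈ S.succs w, levelTerm T S α n (T.pred v) y (a, b) =
      (∑ y ∈ S.succs w, levelWeight r b (S.up y)) * (levelWeight q a (T.up (T.pred v)) *
        killedKernel α a b n (T.hor v - 1)) := by
    rw [Finset.sum_mul]
    refine Finset.sum_congr rfl fun y hy => ?_
    rw [levelTerm, T.hor_pred]
    ring
  rw [e1, e2, levelTerm]
  rcases lt_or_ge (T.hor v) (-(a : ℤ)) with h1 | h1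
  · rw [killedKernel_of_lt h1, killedKernel_of_lt (t := T.hor v - 1) (by omega)]
    rcases lt_or_ge (T.hor v + 1) (-(a : ℤ)) with h2 | h2
    · rw [killedKernel_of_lt h2]; ring
    · rw [T.sum_levelWeight_succs hq (by omega)]; ring
  rcases lt_or_ge (b : ℤ) (T.hor v) with h2 | h2
  · rw [killedKernel_of_gt h2, killedKernel_of_gt (t := T.hor v + 1) (by omega)]
    rcases lt_or_ge (b : ℤ) (T.hor v - 1) with h3 | h3
    · rw [killedKernel_of_gt h3]; ring
    · rw [S.sum_levelWeight_succs hr (by omega)]; ring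
  have f1 : ∑ y ∈ T.succs v, levelWeight q a (T.up y) = q * levelWeight q a (T.up v) := by
    rw [Finset.sum_congr rfl fun y hy => T.levelWeight_up_eq (T.mem_succs.1 hy) h1,
      Finset.sum_const, T.card_succs, nsmul_eq_mul]
  have f2 : ∑ y ∈ S.succs w, levelWeight r b (S.up y) = r * levelWeight r b (S.up w) := by
    rw [Finset.sum_congr rfl fun y hy => S.levelWeight_up_eq (S.mem_succs.1 hy) (by omega),
      Finset.sum_const, S.card_succs, nsmul_eq_mul]
  -- The weight may change when the move leaves the strip, but then the kernel factor is 0.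
  have g1 : levelWeight r b (S.up (S.pred w)) * killedKernel α a b n (T.hor v + 1) =
      levelWeight r b (S.up w) * killedKernel α a b n (T.hor v + 1) := by
    rcases lt_or_ge (b : ℤ) (T.hor v + 1) with h3 | h3
    · rw [killedKernel_of_gt h3]; ring
    · rw [S.levelWeight_up_eq (S.isPred_pred w) (by rw [S.hor_pred]; omega)]
  have g2 : levelWeight q a (T.up (T.pred v)) * killedKernel α a b n (T.hor v - 1) =
      levelWeight q a (T.up v) * killedKernel α a b n (T.hor v - 1) := by
    rcases lt_or_ge (T.hor v - 1) (-(a : ℤ)) with h3 | h3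
    · rw [killedKernel_of_lt h3]; ring
    · rw [T.levelWeight_up_eq (T.isPred_pred v) (by rw [T.hor_pred]; omega)]
  rw [f1, f2, g1, g2, killedKernel_succ hα0 hα1 h1 h2]
  field_simp

theorem eq_origin_iff {x : DL T S} :
    x = origin T S ↔ T.up x.1.1 = 0 ∧ S.up x.1.2 = 0 ∧ T.hor x.1.1 = 0 := by
  constructor
  · rintro rfl
    exact ⟨T.up_ray 0, S.up_ray 0, T.hor_root⟩
  · rintro ⟨h1, h2, h3⟩
    have hx := x.2
    have e1 := T.eq_ray_of_hor (x := x.1.1) (by rw [h1, h3]; simp)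
    have e2 := S.eq_ray_of_hor (x := x.1.2) (by rw [h2]; simp; omega)
    rw [h1] at e1
    rw [h2] at e2
    exact Subtype.ext (Prod.ext e1 e2)

theorem nStep_origin (hq : 2 ≤ q) (hr : 2 ≤ r) {α : ℝ} (hα0 : 0 < α) (hα1 : α < 1) (n : ℕ)
    (x : DL T S) :
    nStep α n x (origin T S) = ∑' p, levelTerm T S α n x.1.1 x.1.2 p := by
  induction n generalizing x with
  | zero =>
    rw [nStep]
    have h := (hasSum_levelWeight hq (T.up x.1.1)).mul (hasSum_levelWeight hr (S.up x.1.2))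
      (Summable.of_norm_bounded ((summable_inv_pow hq).mul_of_nonneg (summable_inv_pow hr)
        (fun a => by positivity) (fun a => by positivity)) fun p => by
          rw [Real.norm_eq_abs, abs_mul]
          gcongr
          · exact abs_levelWeight_le hq _ _
          · exact abs_levelWeight_le hr _ _)
    have h2 := (h.mul_right (if T.hor x.1.1 = 0 then 1 else 0)).tsum_eq
    simp only [levelTerm, killedKernel_zero]
    rw [h2]
    simp only [eq_origin_iff]
    by_cases h1 : T.up x.1.1 = 0 <;> by_cases h2 : S.up x.1.2 = 0 <;>
      by_cases h3 : T.hor x.1.1 = 0 <;> simp [h1, h2, h3]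
  | succ n ih =>
    rw [nStep]
    simp_rw [ih]
    rw [(hasSum_step_mul α x fun v w => ∑' p, levelTerm T S α n v w p).tsum_eq]
    have h1 := (hasSum_sum fun y (_ : y ∈ T.succs x.1.1) =>
      (summable_levelTerm (T := T) (S := S) hq hr α n y (S.pred x.1.2)).hasSum).mul_left (α / q)
    have h2 := (hasSum_sum fun y (_ : y ∈ S.succs x.1.2) =>
      (summable_levelTerm (T := T) (S := S) hq hr α n (T.pred x.1.1) y).hasSum).mul_left
        ((1 - α) / r)
    rw [← (h1.add h2).tsum_eq]
    simp only [levelTerm_succ hq hr hα0 hα1]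

end DL

/-! ### Elementary estimates -/

/-- `cos y · exp (y² / 2)` starts at 1 and decreases on `[0, π/2]`, because `y ≤ tan y`. -/
theorem Real.cos_sq_le_exp_neg_sq {x : ℝ} (h0 : 0 ≤ x) (h1 : x ≤ Real.pi / 2) :
    Real.cos x ^ 2 ≤ Real.exp (-x ^ 2) := by
  have hd : ∀ y, HasDerivAt (fun y => Real.cos y * Real.exp (y ^ 2 / 2))
      (-Real.sin y * Real.exp (y ^ 2 / 2) + Real.cos y * (Real.exp (y ^ 2 / 2) * y)) y := by
    intro y
    have h2 : HasDerivAt (fun y : ℝ => y ^ 2 / 2) y y := by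
      have := (hasDerivAt_pow 2 y).div_const 2
      simpa using this
    exact (Real.hasDerivAt_cos y).mul h2.exp
  have hanti : AntitoneOn (fun y => Real.cos y * Real.exp (y ^ 2 / 2))
      (Set.Icc 0 (Real.pi / 2)) := by
    refine antitoneOn_of_deriv_nonpos (convex_Icc _ _)
      (fun y _ => (hd y).continuousAt.continuousWithinAt)
      (fun y _ => (hd y).differentiableAt.differentiableWithinAt) fun y hy => ?_
    rw [interior_Icc] at hy
    have hc : 0 < Real.cos y := Real.cos_pos_of_mem_Ioo ⟨by linarith [hy.1, hy.2], hy.2⟩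
    have ht := Real.lt_tan hy.1 hy.2
    rw [Real.tan_eq_sin_div_cos, lt_div_iff₀ hc] at ht
    rw [(hd y).deriv]
    nlinarith [Real.exp_pos (y ^ 2 / 2)]
  have h2 := hanti ⟨le_rfl, by positivity⟩ ⟨h0, h1⟩ h0
  simp only [Real.cos_zero, ne_eq, OfNat.ofNat_ne_zero, not_false_eq_true, zero_pow, zero_div,
    Real.exp_zero, mul_one] at h2
  have hc : 0 ≤ Real.cos x := Real.cos_nonneg_of_mem_Icc ⟨by linarith, h1⟩
  have h3 : Real.cos x ≤ Real.exp (-(x ^ 2 / 2)) := by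
    rw [Real.exp_neg, ← one_div, le_div_iff₀ (Real.exp_pos _)]
    exact h2
  calc Real.cos x ^ 2 ≤ Real.exp (-(x ^ 2 / 2)) ^ 2 := by gcongr
    _ = Real.exp (-x ^ 2) := by rw [← Real.exp_nat_mul]; congr 1; push_cast; ring

/-- The matching lower bound: the quartic loss is harmless since `N (π / k)⁴ → 0` for `k` of order
`N^(1/3)`. -/
theorem Real.exp_neg_sq_sub_le_cos_sq {x : ℝ} (hx : x ^ 2 ≤ 1) :
    Real.exp (-x ^ 2 - x ^ 4) ≤ Real.cos x ^ 2 := by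
  have h1 : Real.exp (-(x ^ 2 / 2 + x ^ 4 / 2)) ≤ 1 - x ^ 2 / 2 := by
    rw [Real.exp_neg, ← one_div, div_le_iff₀ (Real.exp_pos _)]
    have h2 := Real.add_one_le_exp (x ^ 2 / 2 + x ^ 4 / 2)
    have h3 : 0 ≤ x ^ 2 := sq_nonneg x
    have h4 : 1 ≤ (1 - x ^ 2 / 2) * (x ^ 2 / 2 + x ^ 4 / 2 + 1) := by
      have : (1 - x ^ 2 / 2) * (x ^ 2 / 2 + x ^ 4 / 2 + 1) =
        1 + (x ^ 2) ^ 2 / 4 * (1 - x ^ 2) := by ring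
      rw [this]
      have : 0 ≤ (x ^ 2) ^ 2 / 4 * (1 - x ^ 2) := mul_nonneg (by positivity) (by linarith)
      linarith
    exact h4.trans (mul_le_mul_of_nonneg_left h2 (by linarith))
  have h2 := h1.trans (Real.one_sub_sq_div_two_le_cos (x := x))
  calc Real.exp (-x ^ 2 - x ^ 4) = Real.exp (-(x ^ 2 / 2 + x ^ 4 / 2)) ^ 2 := by
        rw [← Real.exp_nat_mul]; congr 1; push_cast; ring
    _ ≤ Real.cos x ^ 2 := by gcongr

theorem integrable_exp_neg_mul_abs {L : ℝ} (hL : 0 < L) :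
    MeasureTheory.Integrable fun y : ℝ => Real.exp (-(L * |y|)) := by
  rw [← MeasureTheory.integrableOn_univ, ← Set.Iic_union_Ioi (a := (0 : ℝ))]
  refine MeasureTheory.IntegrableOn.union ?_ ?_
  · refine (integrableOn_exp_mul_Iic hL 0).congr_fun (fun y hy => ?_) measurableSet_Iic
    simp only [abs_of_nonpos (Set.mem_Iic.1 hy)]
    ring_nf
  · refine (integrableOn_exp_mul_Ioi (neg_lt_zero.2 hL) 0).congr_fun (fun y hy => ?_)
      measurableSet_Ioi
    simp only [abs_of_pos (Set.mem_Ioi.1 hy)]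
    ring_nf

/-- A sum over `ℕ` as the integral of a step function. -/
theorem tsum_eq_integral_floor {F : ℕ → ℝ} (hF : Summable F) (h0 : F 0 = 0) :
    ∑' k, F k = ∫ x : ℝ, F ⌊x⌋₊ := by
  have hfl : ∀ (n : ℕ), ∀ x ∈ Set.Ico (n : ℝ) (n + 1), ⌊x⌋₊ = n := fun n x hx =>
    Nat.floor_eq_on_Ico n x hx
  have hU : (⋃ n : ℕ, Set.Ico (n : ℝ) (n + 1)) = Set.Ici 0 := by
    ext x
    simp only [Set.mem_iUnion, Set.mem_Ico, Set.mem_Ici]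
    constructor
    · rintro ⟨n, h1, -⟩
      exact n.cast_nonneg.trans h1
    · intro hx
      exact ⟨⌊x⌋₊, Nat.floor_le hx, Nat.lt_floor_add_one x⟩
  have hdisj : Pairwise (Function.onFun Disjoint fun n : ℕ => Set.Ico (n : ℝ) (n + 1)) := by
    intro m n hmn
    rw [Function.onFun, Set.disjoint_left]
    intro x h1 h2
    exact hmn ((hfl m x h1).symm.trans (hfl n x h2))
  have hmeas : ∀ n : ℕ, MeasurableSet (Set.Ico (n : ℝ) (n + 1)) := fun n => measurableSet_Ico
  have hvol : ∀ n : ℕ, MeasureTheory.volume.real (Set.Ico (n : ℝ) (n + 1)) = 1 := by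
    intro n
    simp [MeasureTheory.measureReal_def]
  have hint : ∀ n : ℕ, ∫ x in Set.Ico (n : ℝ) (n + 1), F ⌊x⌋₊ = F n := by
    intro n
    rw [MeasureTheory.setIntegral_congr_fun (hmeas n) (g := fun _ => F n)
      (fun x hx => by simp only [hfl n x hx]), MeasureTheory.setIntegral_const, hvol]
    simp
  have hnorm : ∀ n : ℕ, ∫ x in Set.Ico (n : ℝ) (n + 1), ‖F ⌊x⌋₊‖ = ‖F n‖ := by
    intro n
    rw [MeasureTheory.setIntegral_congr_fun (hmeas n) (g := fun _ => ‖F n‖)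
      (fun x hx => by simp only [hfl n x hx]), MeasureTheory.setIntegral_const, hvol]
    simp
  have hion : MeasureTheory.IntegrableOn (fun x : ℝ => F ⌊x⌋₊)
      (⋃ n : ℕ, Set.Ico (n : ℝ) (n + 1)) := by
    refine MeasureTheory.integrableOn_iUnion_of_summable_integral_norm (fun n => ?_) ?_
    · refine MeasureTheory.IntegrableOn.congr_fun (f := fun _ => F n) ?_
        (fun x hx => by simp only [hfl n x hx]) (hmeas n)
      exact MeasureTheory.integrableOn_const (by simp)
    · simp_rw [hnorm]
      exact hF.norm
  have h := MeasureTheory.hasSum_integral_iUnion hmeas hdisj hion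
  simp_rw [hint] at h
  rw [h.tsum_eq, hU]
  refine MeasureTheory.setIntegral_eq_integral_of_forall_compl_eq_zero fun x hx => ?_
  rw [Set.mem_Ici, not_le] at hx
  rw [Nat.floor_of_nonpos hx.le, h0]

/-! ### Laplace's method for the dominant term -/

section Laplace

variable {L ξ : ℝ}

/-- The deviation of the phase from its minimum is an exact sum of two nonnegative terms. The first
gives the decay in `k`, the second absorbs the factor `(ν / k) ^ p`; near `k = ξ ν` both enter the
Gaussian. -/
theorem phase_eq (h : L * ξ ^ 3 = 2 * Real.pi ^ 2) (ν : ℝ) {k : ℝ} (hk : k ≠ 0) :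
    L * k + Real.pi ^ 2 * ν ^ 3 / k ^ 2 - 3 / 2 * L * ξ * ν =
      L * (k - ξ * ν) ^ 2 / k + L / 2 * (ξ * ν) * (ξ * ν / k - 1) ^ 2 := by
  have : Real.pi ^ 2 = L * ξ ^ 3 / 2 := by linarith
  rw [this]
  field_simp
  ring

/-- The `k`-th term of the dominant sum, normalized by its maximal exponential rate. -/
noncomputable def laplaceTerm (L ξ : ℝ) (p : ℕ) (γ : ℕ → ℝ) (N : ℕ) (ν : ℝ) (k : ℕ) : ℝ :=
  γ k * (ν / k) ^ p * (Real.exp (3 / 2 * L * ξ * ν - L * k) * Real.cos (Real.pi / k) ^ (2 * N))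

theorem cos_pi_div_pow_le {k : ℕ} (hk : 2 ≤ k) (N : ℕ) :
    Real.cos (Real.pi / k) ^ (2 * N) ≤ Real.exp (-(Real.pi ^ 2 * N / k ^ 2)) := by
  have hk' : (2 : ℝ) ≤ k := by exact_mod_cast hk
  have h := Real.cos_sq_le_exp_neg_sq (x := Real.pi / k) (by positivity)
    (div_le_div_of_nonneg_left Real.pi_pos.le (by norm_num) hk')
  rw [pow_mul]
  calc _ ≤ Real.exp (-(Real.pi / k) ^ 2) ^ N := by gcongr
    _ = _ := by rw [← Real.exp_nat_mul]; congr 1; ring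

/-- In the rescaled variable `z`, `k ≤ ν (ξ + |z|)`, so the right side is at least `z² / (ξ + |z|) ≥
|z| - ξ`. Decay linear in `|z|`, uniform in `ν`, suffices for domination. -/
theorem le_sq_div {ξ ν k : ℝ} (hν : 1 ≤ ν) (hk : 0 < k) :
    |(k - ξ * ν) / √ν| - ξ ≤ (k - ξ * ν) ^ 2 / k := by
  set z := (k - ξ * ν) / √ν with hz
  have hs : 0 < √ν := by positivity
  have hs2 : √ν ^ 2 = ν := Real.sq_sqrt (by linarith)
  have hs1 : √ν ≤ ν := by
    have : 1 ≤ √ν := Real.one_le_sqrt.2 hν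
    nlinarith
  have hd : k - ξ * ν = √ν * z := by rw [hz]; field_simp
  have hk2 : k ≤ ν * (ξ + |z|) := by
    have h1 : √ν * z ≤ ν * |z| :=
      (mul_le_mul_of_nonneg_left (le_abs_self z) hs.le).trans
        (mul_le_mul_of_nonneg_right hs1 (abs_nonneg z))
    linarith
  rw [hd, mul_pow, hs2, le_div_iff₀ hk]
  rcases le_or_gt (|z|) ξ with h | h
  · have : (|z| - ξ) * k ≤ 0 := mul_nonpos_of_nonpos_of_nonneg (by linarith) hk.le
    have : 0 ≤ ν * z ^ 2 := by positivity
    linarith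
  · calc (|z| - ξ) * k ≤ (|z| - ξ) * (ν * (ξ + |z|)) :=
          mul_le_mul_of_nonneg_left hk2 (by linarith)
      _ = ν * (|z| ^ 2 - ξ ^ 2) := by ring
      _ ≤ ν * z ^ 2 := by
          rw [sq_abs]
          exact mul_le_mul_of_nonneg_left (by linarith [sq_nonneg ξ]) (by linarith)

theorem abs_laplaceTerm_le (hL : 0 < L) (hξ : 0 < ξ) (h : L * ξ ^ 3 = 2 * Real.pi ^ 2) (p : ℕ)
    {γ : ℕ → ℝ} {K : ℝ} (hK : ∀ k, |γ k| ≤ K) {N : ℕ} {ν : ℝ} (hν : 1 ≤ ν) (hξν : 1 ≤ ξ * ν)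
    (hN : ν ^ 3 = N) {k : ℕ} (hk : 2 ≤ k) :
    |laplaceTerm L ξ p γ N ν k| ≤ K * (ξ⁻¹ ^ p * Real.exp (p + p ^ 2 / (2 * L))) *
      Real.exp (L * (ξ - |(k - ξ * ν) / √ν|)) := by
  have hk0 : (0 : ℝ) < k := by
    have : 0 < k := by omega
    exact_mod_cast this
  set w := ξ * ν / k with hw
  have hw0 : 0 ≤ w := by positivity
  have e1 : ν / k = ξ⁻¹ * w := by rw [hw]; field_simp
  have hwp : w ^ p ≤ Real.exp (p * w) := by
    rw [Real.exp_nat_mul]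
    gcongr
    linarith [Real.add_one_le_exp w]
  have hphase := phase_eq h ν hk0.ne'
  rw [hN] at hphase
  have hsq := le_sq_div (ξ := ξ) hν hk0
  have hexp : p * w + (3 / 2 * L * ξ * ν - L * k) + -(Real.pi ^ 2 * N / k ^ 2) ≤
      (p + p ^ 2 / (2 * L)) + L * (ξ - |(k - ξ * ν) / √ν|) := by
    have h1 : L * (|(k - ξ * ν) / √ν| - ξ) ≤ L * (k - ξ * ν) ^ 2 / k := by
      rw [mul_div_assoc]
      exact mul_le_mul_of_nonneg_left hsq hL.le
    have h2 : L / 2 * (w - 1) ^ 2 ≤ L / 2 * (ξ * ν) * (w - 1) ^ 2 := by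
      refine mul_le_mul_of_nonneg_right ?_ (sq_nonneg _)
      exact le_mul_of_one_le_right (by positivity) hξν
    -- Completing the square in `w - 1`: the second term of the phase pays for `w ^ p ≤ exp (p w)`.
    have h3 : p * w ≤ p + p ^ 2 / (2 * L) + L / 2 * (w - 1) ^ 2 := by
      have : p + p ^ 2 / (2 * L) + L / 2 * (w - 1) ^ 2 - p * w =
          (L * (w - 1) - p) ^ 2 / (2 * L) := by
        field_simp
        ring
      have : 0 ≤ (L * (w - 1) - p) ^ 2 / (2 * L) := by positivity
      linarith
    linarith
  rw [laplaceTerm, abs_mul, abs_mul, abs_mul, Real.abs_exp, abs_of_nonneg (by positivity :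
    0 ≤ (ν / k) ^ p), abs_of_nonneg (by rw [pow_mul]; positivity :
    0 ≤ Real.cos (Real.pi / k) ^ (2 * N)), e1, mul_pow]
  have hK0 : 0 ≤ K := (abs_nonneg _).trans (hK 0)
  calc |γ k| * (ξ⁻¹ ^ p * w ^ p) * (Real.exp (3 / 2 * L * ξ * ν - L * k) *
        Real.cos (Real.pi / k) ^ (2 * N))
      ≤ K * (ξ⁻¹ ^ p * Real.exp (p * w)) * (Real.exp (3 / 2 * L * ξ * ν - L * k) *
        Real.exp (-(Real.pi ^ 2 * N / k ^ 2))) := by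
        gcongr
        · rw [pow_mul]; positivity
        · exact hK k
        · exact cos_pi_div_pow_le hk N
    _ = K * ξ⁻¹ ^ p * Real.exp (p * w + (3 / 2 * L * ξ * ν - L * k) +
          -(Real.pi ^ 2 * N / k ^ 2)) := by
        rw [Real.exp_add, Real.exp_add]; ring
    _ ≤ K * ξ⁻¹ ^ p * Real.exp ((p + p ^ 2 / (2 * L)) + L * (ξ - |(k - ξ * ν) / √ν|)) := by
        gcongr
    _ = _ := by rw [Real.exp_add]; ring

end Laplace

section Laplace

variable {L ξ : ℝ}

/-- Pointwise limit under `k = ξ ν + √ν y`. The two terms of `phase_eq` tend to `L y² / ξ` and `L y²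
/ (2 ξ)`, whose sum is the Gaussian exponent. -/
theorem tendsto_laplaceTerm (hL : 0 < L) (hξ : 0 < ξ) (h : L * ξ ^ 3 = 2 * Real.pi ^ 2) (p : ℕ)
    {γ : ℕ → ℝ} {κ : ℝ} (hγ : Tendsto γ atTop (nhds κ)) {ν : ℕ → ℝ}
    (hν : Tendsto ν atTop atTop) (hN : ∀ N, ν N ^ 3 = N) (y : ℝ) :
    Tendsto (fun N => laplaceTerm L ξ p γ N (ν N) ⌊ξ * ν N + √(ν N) * y⌋₊) atTop
      (nhds (κ * ξ⁻¹ ^ p * Real.exp (-(3 * L / (2 * ξ)) * y ^ 2))) := by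
  have hs : Tendsto (fun N => √(ν N)) atTop atTop := Real.tendsto_sqrt_atTop.comp hν
  have hνpos : ∀ᶠ N in atTop, 0 < ν N := hν.eventually_gt_atTop 0
  have hX : Tendsto (fun N => ξ * ν N + √(ν N) * y) atTop atTop := by
    have h1 : Tendsto (fun N => √(ν N) * (ξ * √(ν N) + y)) atTop atTop :=
      hs.atTop_mul_atTop₀ (tendsto_atTop_add_const_right _ _ (hs.const_mul_atTop hξ))
    refine h1.congr' ?_
    filter_upwards [hνpos] with N hN0
    have := Real.mul_self_sqrt hN0.le
    linear_combination ξ * this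
  set k : ℕ → ℕ := fun N => ⌊ξ * ν N + √(ν N) * y⌋₊ with hk
  have hkt : Tendsto k atTop atTop := tendsto_nat_floor_atTop.comp hX
  have hkpos : ∀ᶠ N in atTop, (0 : ℝ) < k N := by
    filter_upwards [hkt.eventually_gt_atTop 0] with N hN0
    exact_mod_cast hN0
  set z : ℕ → ℝ := fun N => (k N - ξ * ν N) / √(ν N) with hz
  have hinv : Tendsto (fun N => (√(ν N))⁻¹) atTop (nhds 0) := tendsto_inv_atTop_zero.comp hs
  have hzy : Tendsto z atTop (nhds y) := by
    have h1 : Tendsto (fun N => y - (√(ν N))⁻¹) atTop (nhds y) := by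
      simpa using hinv.const_sub y
    refine tendsto_of_tendsto_of_tendsto_of_le_of_le' h1 tendsto_const_nhds ?_ ?_
    · filter_upwards [hνpos] with N hN0
      have h2 := Nat.lt_floor_add_one (ξ * ν N + √(ν N) * y)
      have h3 : 0 < √(ν N) := Real.sqrt_pos.2 hN0
      rw [hz, le_div_iff₀ h3, sub_mul, inv_mul_cancel₀ h3.ne']
      simp only [hk]
      linarith
    · filter_upwards [hνpos, hX.eventually_ge_atTop 0] with N hN0 hX0
      have h2 := Nat.floor_le hX0
      have h3 : 0 < √(ν N) := Real.sqrt_pos.2 hN0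
      rw [hz, div_le_iff₀ h3]
      simp only [hk]
      linarith
  have hkν : Tendsto (fun N => k N / ν N) atTop (nhds ξ) := by
    have h1 : Tendsto (fun N => ξ + z N * (√(ν N))⁻¹) atTop (nhds ξ) := by
      simpa using (hzy.mul hinv).const_add ξ
    refine h1.congr' ?_
    filter_upwards [hνpos] with N hN0
    have h3 : 0 < √(ν N) := Real.sqrt_pos.2 hN0
    have h4 := Real.sq_sqrt hN0.le
    simp only [hz]
    field_simp
    rw [h4]
    field_simp
    ring
  have hνk : Tendsto (fun N => ν N / k N) atTop (nhds ξ⁻¹) := by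
    simpa using hkν.inv₀ hξ.ne'
  have hcos : Tendsto (fun N => Real.cos (Real.pi / k N) ^ (2 * N) *
      Real.exp (Real.pi ^ 2 * N / k N ^ 2)) atTop (nhds 1) := by
    have h1 : Tendsto (fun N => Real.exp (-(Real.pi ^ 4 * ((ν N / k N) ^ 4 * (ν N)⁻¹)))) atTop
        (nhds 1) := by
      have := (((hνk.pow 4).mul (tendsto_inv_atTop_zero.comp hν)).const_mul (Real.pi ^ 4)).neg
      rw [mul_zero, mul_zero, neg_zero] at this
      simpa [Function.comp_def] using (Real.continuous_exp.tendsto 0).comp this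
    refine tendsto_of_tendsto_of_tendsto_of_le_of_le' h1 tendsto_const_nhds ?_ ?_
    · filter_upwards [hνpos, hkt.eventually_ge_atTop 4] with N hN0 hk4
      have hk4' : (4 : ℝ) ≤ k N := by exact_mod_cast hk4
      have hk0 : (0 : ℝ) < k N := by linarith
      have hx : (Real.pi / k N) ^ 2 ≤ 1 := by
        have : Real.pi / k N ≤ 1 := by
          rw [div_le_one hk0]
          linarith [Real.pi_lt_four]
        exact pow_le_one₀ (by positivity) this
      have h2 := Real.exp_neg_sq_sub_le_cos_sq hx
      calc Real.exp (-(Real.pi ^ 4 * ((ν N / k N) ^ 4 * (ν N)⁻¹)))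
          = Real.exp (-(Real.pi / k N) ^ 2 - (Real.pi / k N) ^ 4) ^ N *
            Real.exp (Real.pi ^ 2 * N / k N ^ 2) := by
            rw [← Real.exp_nat_mul, ← Real.exp_add, ← hN N]
            congr 1
            field_simp
            ring
        _ ≤ (Real.cos (Real.pi / k N) ^ 2) ^ N * Real.exp (Real.pi ^ 2 * N / k N ^ 2) := by
            gcongr
        _ = _ := by rw [← pow_mul]
    · filter_upwards [hkt.eventually_ge_atTop 2] with N hk2
      calc _ ≤ Real.exp (-(Real.pi ^ 2 * N / k N ^ 2)) *
            Real.exp (Real.pi ^ 2 * N / k N ^ 2) := by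
            gcongr
            exact cos_pi_div_pow_le hk2 N
        _ = 1 := by rw [← Real.exp_add, neg_add_cancel, Real.exp_zero]
  have hexp : Tendsto (fun N => Real.exp (-(L * z N ^ 2 / (k N / ν N) +
      L / 2 * ξ * z N ^ 2 / (k N / ν N) ^ 2))) atTop
      (nhds (Real.exp (-(3 * L / (2 * ξ)) * y ^ 2))) := by
    have h1 := ((((hzy.pow 2).const_mul L).div hkν hξ.ne').add
      (((hzy.pow 2).const_mul (L / 2 * ξ)).div (hkν.pow 2) (by positivity))).neg
    have h2 : -(L * y ^ 2 / ξ + L / 2 * ξ * y ^ 2 / ξ ^ 2) = -(3 * L / (2 * ξ)) * y ^ 2 := by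
      field_simp
      ring
    rw [h2] at h1
    exact (Real.continuous_exp.tendsto _).comp h1
  have hmain := ((hγ.comp hkt).mul (hνk.pow p)).mul (hexp.mul hcos)
  rw [mul_one] at hmain
  refine hmain.congr' ?_
  filter_upwards [hνpos, hkpos] with N hN0 hk0
  have hph := phase_eq h (ν N) hk0.ne'
  have hz2 : z N ^ 2 * ν N = (k N - ξ * ν N) ^ 2 := by
    rw [hz, div_pow, Real.sq_sqrt hN0.le]
    field_simp
  have e : -(L * z N ^ 2 / (k N / ν N) + L / 2 * ξ * z N ^ 2 / (k N / ν N) ^ 2) +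
      Real.pi ^ 2 * N / k N ^ 2 = 3 / 2 * L * ξ * ν N - L * k N := by
    have e1 : L * z N ^ 2 / (k N / ν N) = L * (k N - ξ * ν N) ^ 2 / k N := by
      rw [← hz2]; field_simp
    have e2 : L / 2 * ξ * z N ^ 2 / (k N / ν N) ^ 2 =
        L / 2 * (ξ * ν N) * (ξ * ν N / k N - 1) ^ 2 := by
      have : (ξ * ν N / k N - 1) ^ 2 = z N ^ 2 * ν N / k N ^ 2 := by
        rw [hz2]; field_simp; ring
      rw [this]; field_simp
    rw [e1, e2, ← hN N]
    linarith
  simp only [laplaceTerm, Function.comp_apply]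
  rw [← e, Real.exp_add]
  ring

theorem summable_laplaceTerm (hL : 0 < L) (ξ : ℝ) (p : ℕ) {γ : ℕ → ℝ} {K : ℝ}
    (hK : ∀ k, |γ k| ≤ K) (h0 : γ 0 = 0) (N : ℕ) {ν : ℝ} (hν : 0 ≤ ν) :
    Summable (laplaceTerm L ξ p γ N ν) := by
  have hK0 : 0 ≤ K := (abs_nonneg _).trans (hK 0)
  have hg : Summable fun k : ℕ => K * ν ^ p * Real.exp (3 / 2 * L * ξ * ν) * Real.exp (-L) ^ k :=
    (summable_geometric_of_lt_one (Real.exp_pos _).le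
      (Real.exp_lt_one_iff.2 (by linarith))).mul_left _
  refine Summable.of_norm_bounded hg fun k => ?_
  rcases Nat.eq_zero_or_pos k with rfl | hk
  · rw [laplaceTerm, h0, zero_mul, zero_mul, norm_zero]
    positivity
  · have hk1 : (1 : ℝ) ≤ k := by exact_mod_cast hk
    have hc : Real.cos (Real.pi / k) ^ (2 * N) ≤ 1 := by
      rw [pow_mul]
      exact pow_le_one₀ (sq_nonneg _) (Real.cos_sq_le_one _)
    rw [laplaceTerm, Real.norm_eq_abs, abs_mul, abs_mul, abs_mul, Real.abs_exp,
      abs_of_nonneg (by positivity : 0 ≤ (ν / k) ^ p),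
      abs_of_nonneg (by rw [pow_mul]; positivity : 0 ≤ Real.cos (Real.pi / k) ^ (2 * N)),
      ← Real.exp_nat_mul]
    have e : Real.exp (3 / 2 * L * ξ * ν - L * k) =
        Real.exp (3 / 2 * L * ξ * ν) * Real.exp (k * -L) := by
      rw [← Real.exp_add]; congr 1; ring
    rw [e]
    calc _ ≤ K * ν ^ p * (Real.exp (3 / 2 * L * ξ * ν) * Real.exp (k * -L) * 1) := by
          gcongr
          · rw [pow_mul]; positivity
          · exact hK k
          · exact div_le_self hν hk1
      _ = _ := by ring

/-- Laplace's method for the dominant sum. -/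
theorem tendsto_tsum_laplaceTerm (hL : 0 < L) (hξ : 0 < ξ) (h : L * ξ ^ 3 = 2 * Real.pi ^ 2)
    (p : ℕ) {γ : ℕ → ℝ} {κ K : ℝ} (hγ : Tendsto γ atTop (nhds κ)) (hK : ∀ k, |γ k| ≤ K)
    (h0 : γ 0 = 0) (h1 : γ 1 = 0) {ν : ℕ → ℝ} (hν : Tendsto ν atTop atTop)
    (hN : ∀ N, ν N ^ 3 = N) :
    Tendsto (fun N => (√(ν N))⁻¹ * ∑' k, laplaceTerm L ξ p γ N (ν N) k) atTop
      (nhds (κ * ξ⁻¹ ^ p * √(2 * Real.pi * ξ / (3 * L)))) := by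
  have hz : ∀ N ν, laplaceTerm L ξ p γ N ν 0 = 0 := fun N ν => by simp [laplaceTerm, h0]
  have ho : ∀ N ν, laplaceTerm L ξ p γ N ν 1 = 0 := fun N ν => by simp [laplaceTerm, h1]
  set M := K * (ξ⁻¹ ^ p * Real.exp (p + p ^ 2 / (2 * L))) with hM
  have hM0 : 0 ≤ M := by
    have : 0 ≤ K := (abs_nonneg _).trans (hK 0)
    positivity
  have hlim : ∫ y : ℝ, κ * ξ⁻¹ ^ p * Real.exp (-(3 * L / (2 * ξ)) * y ^ 2) =
      κ * ξ⁻¹ ^ p * √(2 * Real.pi * ξ / (3 * L)) := by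
    rw [MeasureTheory.integral_const_mul, integral_gaussian]
    congr 2
    field_simp
  rw [← hlim]
  -- The sum over `k` is the integral of a step function; translating by `ξ ν` and scaling by `√ν`
  -- produces the factor `(√ν)⁻¹` and an integrand dominated uniformly in large `N`.
  have hdom : Tendsto (fun N => ∫ y : ℝ,
      laplaceTerm L ξ p γ N (ν N) ⌊ξ * ν N + √(ν N) * y⌋₊) atTop
      (nhds (∫ y : ℝ, κ * ξ⁻¹ ^ p * Real.exp (-(3 * L / (2 * ξ)) * y ^ 2))) := by
    refine MeasureTheory.tendsto_integral_filter_of_dominated_convergence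
      (fun y => M * Real.exp (L * (ξ + 1)) * Real.exp (-(L * |y|))) ?_ ?_ ?_ ?_
    · refine Eventually.of_forall fun N => Measurable.aestronglyMeasurable ?_
      have : Measurable fun y : ℝ => ξ * ν N + √(ν N) * y := by fun_prop
      exact (measurable_from_nat (f := laplaceTerm L ξ p γ N (ν N))).comp
        (Nat.measurable_floor.comp this)
    · filter_upwards [hν.eventually_ge_atTop 1, hν.eventually_ge_atTop ξ⁻¹] with N hν1 hνξ
      refine Eventually.of_forall fun y => ?_
      set X := ξ * ν N + √(ν N) * y with hX
      rw [Real.norm_eq_abs]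
      rcases lt_or_ge ⌊X⌋₊ 2 with hk | hk
      · have : laplaceTerm L ξ p γ N (ν N) ⌊X⌋₊ = 0 := by
          interval_cases ⌊X⌋₊
          · exact hz _ _
          · exact ho _ _
        rw [this, abs_zero]
        positivity
      · have hξν : 1 ≤ ξ * ν N := by
          calc 1 = ξ * ξ⁻¹ := by field_simp
            _ ≤ ξ * ν N := by gcongr
        refine (abs_laplaceTerm_le hL hξ h p hK hν1 hξν (hN N) hk).trans ?_
        rw [← hM, mul_assoc M, ← Real.exp_add]
        refine mul_le_mul_of_nonneg_left (Real.exp_le_exp.2 ?_) hM0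
        have hX0 : 0 ≤ X := by
          by_contra hcon
          rw [Nat.floor_of_nonpos (le_of_not_ge hcon)] at hk
          omega
        have hs : 1 ≤ √(ν N) := Real.one_le_sqrt.2 hν1
        have hs0 : 0 < √(ν N) := by linarith
        have f1 := Nat.floor_le hX0
        have f2 := Nat.lt_floor_add_one X
        -- Rounding moves the rescaled variable by at most `1 / √ν ≤ 1`; hence `ξ + 1` in the
        -- dominating function.
        have f3 : |((⌊X⌋₊ : ℝ) - ξ * ν N) / √(ν N) - y| ≤ 1 := by
          have : ((⌊X⌋₊ : ℝ) - ξ * ν N) / √(ν N) - y = (⌊X⌋₊ - X) / √(ν N) := by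
            rw [hX]; field_simp; ring
          rw [this, abs_div, abs_of_pos hs0, div_le_one hs0, abs_le]
          constructor <;> linarith
        have f4 : |y| ≤ |((⌊X⌋₊ : ℝ) - ξ * ν N) / √(ν N)| + 1 := by
          have := abs_sub_abs_le_abs_sub y (((⌊X⌋₊ : ℝ) - ξ * ν N) / √(ν N))
          rw [abs_sub_comm] at f3
          linarith
        nlinarith
    · exact (integrable_exp_neg_mul_abs hL).const_mul _
    · exact Eventually.of_forall fun y => tendsto_laplaceTerm hL hξ h p hγ hν hN y
  refine hdom.congr' ?_
  filter_upwards [hν.eventually_gt_atTop 0] with N hν0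
  rw [tsum_eq_integral_floor (summable_laplaceTerm hL ξ p hK h0 N hν0.le) (hz _ _)]
  have e1 := MeasureTheory.Measure.integral_comp_mul_left
    (fun x => laplaceTerm L ξ p γ N (ν N) ⌊ξ * ν N + x⌋₊) √(ν N)
  rw [e1, MeasureTheory.integral_add_left_eq_self
    (fun x : ℝ => laplaceTerm L ξ p γ N (ν N) ⌊x⌋₊) (ξ * ν N), smul_eq_mul,
    abs_of_pos (inv_pos.2 (Real.sqrt_pos.2 hν0))]

end Laplace

/-! ### The spectral sum -/

/-- The total weight of the squares of the `j`-th eigenfunction of the path `{1, …, k - 1}`, where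
the vertex `b + 1` has weight `s ^ b`. -/
noncomputable def spectralWeight (s : ℝ) (k j : ℕ) : ℝ :=
  2 / k * ∑ b ∈ Finset.range (k - 1), s ^ b * Real.sin (j * (Real.pi * (b + 1) / k)) ^ 2

/-- The sum of the eigenvalue powers `cos (j π / k) ^ (2 N)` with their spectral weights. -/
noncomputable def spectralSum (s : ℝ) (N k : ℕ) : ℝ :=
  ∑ j ∈ Finset.range k, spectralWeight s k j * Real.cos (j * (Real.pi / k)) ^ (2 * N)

section spectral

variable {s : ℝ}

theorem spectralWeight_index_zero (s : ℝ) (k : ℕ) : spectralWeight s k 0 = 0 := by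
  simp [spectralWeight]

theorem spectralWeight_of_le_one (s : ℝ) {k : ℕ} (hk : k ≤ 1) (j : ℕ) :
    spectralWeight s k j = 0 := by
  have : k - 1 = 0 := by omega
  simp [spectralWeight, this]

theorem spectralWeight_nonneg (hs : 0 ≤ s) (k j : ℕ) : 0 ≤ spectralWeight s k j := by
  unfold spectralWeight
  positivity

theorem spectralWeight_le_two (hs : 0 ≤ s) (hs1 : s ≤ 1) (k j : ℕ) :
    spectralWeight s k j ≤ 2 := by
  rcases Nat.eq_zero_or_pos k with rfl | hk
  · simp [spectralWeight]
  · have hk' : (0 : ℝ) < k := by exact_mod_cast hk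
    have h : ∑ b ∈ Finset.range (k - 1), s ^ b * Real.sin (j * (Real.pi * (b + 1) / k)) ^ 2 ≤ k := by
      refine (Finset.sum_le_card_nsmul _ _ 1 fun b _ => ?_).trans ?_
      · exact mul_le_one₀ (pow_le_one₀ hs hs1) (sq_nonneg _) (Real.sin_sq_le_one _)
      · rw [Finset.card_range, nsmul_eq_mul, mul_one]
        exact_mod_cast Nat.sub_le k 1
    calc spectralWeight s k j ≤ 2 / k * k := by
          unfold spectralWeight
          gcongr
      _ = 2 := by field_simp

theorem spectralWeight_sub_one (s : ℝ) {k : ℕ} (hk : 1 ≤ k) :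
    spectralWeight s k (k - 1) = spectralWeight s k 1 := by
  have hk' : (k : ℝ) ≠ 0 := by positivity
  unfold spectralWeight
  congr 1
  refine Finset.sum_congr rfl fun b _ => ?_
  congr 1
  have e : ((k - 1 : ℕ) : ℝ) * (Real.pi * (b + 1) / k) =
      ((b + 1 : ℕ) : ℝ) * Real.pi - (1 : ℕ) * (Real.pi * (b + 1) / k) := by
    rw [Nat.cast_sub hk]
    push_cast
    field_simp
  rw [e, Real.sin_sub, Real.sin_nat_mul_pi, Real.cos_nat_mul_pi, zero_mul, zero_sub, neg_sq,
    mul_pow, ← pow_mul, mul_comm (b + 1) 2, pow_mul]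
  simp

/-- The reflection `j ↦ k - j` preserves `cos²`, so one may assume `j ≤ k / 2`, where the Gaussian
bound applies. -/
theorem cos_sq_le_of_mem {j k : ℕ} (h2 : 2 ≤ j) (hjk : j + 2 ≤ k) :
    Real.cos (j * (Real.pi / k)) ^ 2 ≤ Real.exp (-(2 * (Real.pi / k)) ^ 2) := by
  have hk : (0 : ℝ) < k := by
    have : 0 < k := by omega
    exact_mod_cast this
  have aux : ∀ i : ℕ, 2 ≤ i → 2 * i ≤ k →
      Real.cos (i * (Real.pi / k)) ^ 2 ≤ Real.exp (-(2 * (Real.pi / k)) ^ 2) := by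
    intro i hi hik
    have hi' : (2 : ℝ) ≤ i := by exact_mod_cast hi
    have hik' : (2 : ℝ) * i ≤ k := by exact_mod_cast hik
    refine (Real.cos_sq_le_exp_neg_sq (by positivity) ?_).trans ?_
    · rw [← mul_div_assoc, div_le_div_iff₀ hk two_pos]
      nlinarith [Real.pi_pos]
    · gcongr
  rcases le_or_gt (2 * j) k with h | h
  · exact aux j h2 h
  · have h1 := aux (k - j) (by omega) (by omega)
    have e : ((k - j : ℕ) : ℝ) * (Real.pi / k) = Real.pi - j * (Real.pi / k) := by
      rw [Nat.cast_sub (by omega)]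
      field_simp
    rwa [e, Real.cos_pi_sub, neg_sq] at h1

theorem abs_spectralSum_sub_le (hs : 0 ≤ s) (hs1 : s ≤ 1) {N : ℕ} (hN : 1 ≤ N) (k : ℕ) :
    |spectralSum s N k - 2 * (spectralWeight s k 1 * Real.cos (Real.pi / k) ^ (2 * N))| ≤
      2 * k * Real.exp (-(4 * Real.pi ^ 2 * N / k ^ 2)) := by
  have hnn : (0 : ℝ) ≤ 2 * k * Real.exp (-(4 * Real.pi ^ 2 * N / k ^ 2)) := by positivity
  rcases le_or_gt k 1 with hk1 | hk1
  · simp only [spectralSum, spectralWeight_of_le_one s hk1, zero_mul, Finset.sum_const_zero,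
      mul_zero, sub_zero, abs_zero]
    exact hnn
  -- For `k = 2` the indices `1` and `k - 1` coincide and the factor 2 overcounts, but `cos (π / 2)
  -- = 0` and `N ≥ 1`.
  rcases eq_or_lt_of_le (Nat.succ_le_of_lt hk1) with hk2 | hk2
  · have h0 : Real.cos (Real.pi / (2 : ℕ)) = 0 := by
      push_cast
      exact Real.cos_pi_div_two
    subst hk2
    have : 2 * N ≠ 0 := by omega
    simp only [spectralSum, Finset.sum_range_succ, Finset.sum_range_zero,
      spectralWeight_index_zero, Nat.cast_one, one_mul]
    simp only [Nat.succ_eq_add_one, Nat.reduceAdd] at *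
    rw [h0, zero_pow this]
    simpa using hnn
  obtain ⟨m, rfl⟩ : ∃ m, k = m + 3 := ⟨k - 3, by omega⟩
  have hlast : Real.cos ((m + 2 : ℕ) * (Real.pi / (m + 3 : ℕ))) ^ (2 * N) =
      Real.cos (Real.pi / (m + 3 : ℕ)) ^ (2 * N) := by
    have e : ((m + 2 : ℕ) : ℝ) * (Real.pi / (m + 3 : ℕ)) = Real.pi - Real.pi / (m + 3 : ℕ) := by
      push_cast
      field_simp
      ring
    rw [e, Real.cos_pi_sub, pow_mul, neg_sq, ← pow_mul]
  have hw := spectralWeight_sub_one s (k := m + 3) (by omega)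
  rw [show m + 3 - 1 = m + 2 by omega] at hw
  have hsum : spectralSum s N (m + 3) -
      2 * (spectralWeight s (m + 3) 1 * Real.cos (Real.pi / (m + 3 : ℕ)) ^ (2 * N)) =
      ∑ i ∈ Finset.range m, spectralWeight s (m + 3) (i + 2) *
        Real.cos ((i + 2 : ℕ) * (Real.pi / (m + 3 : ℕ))) ^ (2 * N) := by
    rw [spectralSum, Finset.sum_range_succ, Finset.sum_range_succ', Finset.sum_range_succ', hlast,
      hw, spectralWeight_index_zero]
    simp only [zero_add, Nat.cast_one, one_mul, add_assoc, Nat.reduceAdd]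
    ring
  rw [hsum]
  refine (Finset.abs_sum_le_sum_abs _ _).trans ?_
  refine (Finset.sum_le_card_nsmul _ _
    (2 * Real.exp (-(4 * Real.pi ^ 2 * N / (m + 3 : ℕ) ^ 2))) fun i hi => ?_).trans ?_
  · rw [Finset.mem_range] at hi
    have h1 := cos_sq_le_of_mem (j := i + 2) (k := m + 3) (by omega) (by omega)
    rw [abs_mul, abs_of_nonneg (spectralWeight_nonneg hs _ _), pow_mul,
      abs_of_nonneg (by positivity)]
    have h2 : (Real.cos ((i + 2 : ℕ) * (Real.pi / (m + 3 : ℕ))) ^ 2) ^ N ≤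
        Real.exp (-(4 * Real.pi ^ 2 * N / (m + 3 : ℕ) ^ 2)) := by
      calc _ ≤ Real.exp (-(2 * (Real.pi / (m + 3 : ℕ))) ^ 2) ^ N := by gcongr
        _ = _ := by
          rw [← Real.exp_nat_mul]
          congr 1
          ring
    exact mul_le_mul (spectralWeight_le_two hs hs1 _ _) h2 (by positivity) two_pos.le
  · rw [Finset.card_range, nsmul_eq_mul]
    have : (m : ℝ) ≤ (m + 3 : ℕ) := by push_cast; linarith
    nlinarith [Real.exp_pos (-(4 * Real.pi ^ 2 * N / (m + 3 : ℕ) ^ 2))]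

end spectral

/-! ### Negligible eigenvalues and the limit of the weighted spectral sums -/

section Laplace

variable {L ξ s : ℝ}

/-- With `4π²` in place of `π²` the minimal cost exceeds `3/2 L ξ ν` by a fixed proportion. Part of
`L k` is kept to make the sum over `k` converge. -/
theorem rest_phase_le (hL : 0 < L) (hξ : 0 < ξ) (h : L * ξ ^ 3 = 2 * Real.pi ^ 2) {ν k : ℝ}
    (hν : 0 ≤ ν) (hk : 0 < k) :
    3 / 2 * L * ξ * ν - L * k - 4 * Real.pi ^ 2 * ν ^ 3 / k ^ 2 ≤
      -(3 / 8 * L * ξ * ν) - L / 4 * k := by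
  have e : 4 * Real.pi ^ 2 * ν ^ 3 = 2 * L * (ξ * ν) ^ 3 := by
    linear_combination (-2 * ν ^ 3) * h
  rw [e]
  set x := ξ * ν with hx
  have hx0 : 0 ≤ x := by positivity
  -- This is `3/4 k³ - 15/8 x k² + 2 x³`. The double root `5/3 x` is a rational stand-in for the
  -- minimizer `(16/3)^(1/3) x` of `3/4 k + 2 x³ / k²`.
  have key : 0 ≤ (k - 5 / 3 * x) ^ 2 * (2 * k + 5 / 3 * x) * (3 / 8) + 19 / 72 * x ^ 3 := by
    positivity
  have : 3 / 2 * L * ξ * ν - L * k - 2 * L * x ^ 3 / k ^ 2 =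
      -(3 / 8 * L * ξ * ν) - L / 4 * k - L * ((k - 5 / 3 * x) ^ 2 * (2 * k + 5 / 3 * x) * (3 / 8) +
        19 / 72 * x ^ 3) / k ^ 2 := by
    have e1 : 3 / 2 * L * ξ * ν = 3 / 2 * L * x := by rw [hx]; ring
    have e2 : 3 / 8 * L * ξ * ν = 3 / 8 * L * x := by rw [hx]; ring
    rw [e1, e2]
    field_simp
    ring
  rw [this]
  have : 0 ≤ L * ((k - 5 / 3 * x) ^ 2 * (2 * k + 5 / 3 * x) * (3 / 8) +
        19 / 72 * x ^ 3) / k ^ 2 := by positivity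
  linarith

theorem tendsto_pow_mul_exp_neg_mul {c : ℝ} (hc : 0 < c) (p : ℕ) :
    Tendsto (fun x : ℝ => x ^ p * Real.exp (-(c * x))) atTop (nhds 0) := by
  have h := ((Real.tendsto_pow_mul_exp_neg_atTop_nhds_zero p).comp
    (tendsto_id.const_mul_atTop hc)).const_mul (c⁻¹ ^ p)
  rw [mul_zero] at h
  refine h.congr fun x => ?_
  simp only [Function.comp_apply, id, mul_pow]
  rw [← mul_assoc, ← mul_assoc, ← mul_pow, inv_mul_cancel₀ hc.ne', one_pow, one_mul]

theorem summable_natCast_mul_exp_neg {c : ℝ} (hc : 0 < c) :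
    Summable fun k : ℕ => 2 * (k : ℝ) * Real.exp (-(c * k)) := by
  have h := (summable_pow_mul_geometric_of_norm_lt_one 1 (r := Real.exp (-c))
    (by rw [Real.norm_eq_abs, Real.abs_exp]; exact Real.exp_lt_one_iff.2 (by linarith))).mul_left 2
  refine h.congr fun k => ?_
  rw [pow_one, ← Real.exp_nat_mul, mul_assoc]
  congr 3
  ring

/-- The asymptotic behaviour of the exponentially weighted spectral sums. -/
theorem tendsto_tsum_spectralSum (hL : 0 < L) (hξ : 0 < ξ) (h : L * ξ ^ 3 = 2 * Real.pi ^ 2)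
    (hs : 0 ≤ s) (hs1 : s ≤ 1) (p : ℕ) {κ : ℝ}
    (hκ : Tendsto (fun k : ℕ => (k : ℝ) ^ p * spectralWeight s k 1) atTop (nhds κ)) {ν : ℕ → ℝ}
    (hν : Tendsto ν atTop atTop) (hN : ∀ N, ν N ^ 3 = N) :
    Tendsto (fun N => ν N ^ p * (√(ν N))⁻¹ * Real.exp (3 / 2 * L * ξ * ν N) *
      ∑' k : ℕ, Real.exp (-(L * k)) * spectralSum s N k) atTop
      (nhds (2 * κ * ξ⁻¹ ^ p * √(2 * Real.pi * ξ / (3 * L)))) := by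
  obtain ⟨K, hK⟩ : ∃ K, ∀ k : ℕ, |(k : ℝ) ^ p * spectralWeight s k 1| ≤ K := by
    obtain ⟨K, hK⟩ := (Metric.isBounded_range_of_tendsto _ hκ).exists_norm_le
    exact ⟨K, fun k => hK _ ⟨k, rfl⟩⟩
  set γ : ℕ → ℝ := fun k => (k : ℝ) ^ p * spectralWeight s k 1 with hγ
  have h0 : γ 0 = 0 := by simp [hγ, spectralWeight_of_le_one]
  have h1 : γ 1 = 0 := by simp [hγ, spectralWeight_of_le_one]
  have hmain := (tendsto_tsum_laplaceTerm hL hξ h p hκ hK h0 h1 hν hN).const_mul 2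
  set D : ℕ → ℕ → ℝ := fun N k => Real.exp (-(L * k)) * (spectralSum s N k -
    2 * (spectralWeight s k 1 * Real.cos (Real.pi / k) ^ (2 * N))) with hD
  have hDle : ∀ N, 1 ≤ N → 1 ≤ ν N → ∀ k, ‖D N k‖ ≤
      Real.exp (-(15 / 8 * L * ξ * ν N)) * (2 * (k : ℝ) * Real.exp (-(L / 4 * k))) := by
    intro N hN1 hν1 k
    rw [hD, Real.norm_eq_abs, abs_mul, Real.abs_exp]
    rcases Nat.eq_zero_or_pos k with rfl | hk
    · simp [spectralSum, spectralWeight_of_le_one]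
    have hk' : (0 : ℝ) < k := by exact_mod_cast hk
    have hph := rest_phase_le hL hξ h (ν := ν N) (by linarith) hk'
    rw [hN N] at hph
    calc _ ≤ Real.exp (-(L * k)) * (2 * k * Real.exp (-(4 * Real.pi ^ 2 * N / k ^ 2))) := by
          gcongr
          exact abs_spectralSum_sub_le hs hs1 hN1 k
      _ = 2 * k * Real.exp (-(L * k) + -(4 * Real.pi ^ 2 * N / k ^ 2)) := by
          rw [Real.exp_add]; ring
      _ ≤ 2 * k * Real.exp (-(15 / 8 * L * ξ * ν N) + -(L / 4 * k)) :=
          mul_le_mul_of_nonneg_left (Real.exp_le_exp.2 (by linarith)) (by positivity)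
      _ = _ := by rw [Real.exp_add]; ring
  have hsum0 := summable_natCast_mul_exp_neg (c := L / 4) (by positivity)
  have hDsum : ∀ N, 1 ≤ N → 1 ≤ ν N → Summable (D N) := fun N hN1 hν1 =>
    Summable.of_norm_bounded (hsum0.mul_left _) (hDle N hN1 hν1)
  have hrest : Tendsto (fun N => ν N ^ p * (√(ν N))⁻¹ * Real.exp (3 / 2 * L * ξ * ν N) *
      ∑' k, D N k) atTop (nhds 0) := by
    have hb := ((tendsto_pow_mul_exp_neg_mul (c := 3 / 8 * L * ξ) (by positivity) p).comp
      hν).mul_const (∑' k : ℕ, 2 * (k : ℝ) * Real.exp (-(L / 4 * k)))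
    rw [zero_mul] at hb
    refine squeeze_zero_norm' ?_ hb
    filter_upwards [eventually_ge_atTop 1, hν.eventually_ge_atTop 1] with N hN1 hν1
    have hsq : 1 ≤ √(ν N) := Real.one_le_sqrt.2 hν1
    have hts : ‖∑' k, D N k‖ ≤ Real.exp (-(15 / 8 * L * ξ * ν N)) *
        ∑' k : ℕ, 2 * (k : ℝ) * Real.exp (-(L / 4 * k)) :=
      tsum_of_norm_bounded (hsum0.hasSum.mul_left _) (hDle N hN1 hν1)
    rw [norm_mul, Real.norm_of_nonneg (by positivity)]
    have hT : 0 ≤ ∑' k : ℕ, 2 * (k : ℝ) * Real.exp (-(L / 4 * k)) :=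
      tsum_nonneg fun k => by positivity
    calc _ ≤ ν N ^ p * 1 * Real.exp (3 / 2 * L * ξ * ν N) *
          (Real.exp (-(15 / 8 * L * ξ * ν N)) *
            ∑' k : ℕ, 2 * (k : ℝ) * Real.exp (-(L / 4 * k))) := by
          gcongr
          exact inv_le_one_of_one_le₀ hsq
      _ = ν N ^ p * Real.exp (3 / 2 * L * ξ * ν N + -(15 / 8 * L * ξ * ν N)) *
            ∑' k : ℕ, 2 * (k : ℝ) * Real.exp (-(L / 4 * k)) := by
          rw [Real.exp_add]; ring
      _ = _ := by
          simp only [Function.comp_apply]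
          congr 3
          ring
  have htot := hmain.add hrest
  rw [add_zero, show 2 * (κ * ξ⁻¹ ^ p * √(2 * Real.pi * ξ / (3 * L))) =
    2 * κ * ξ⁻¹ ^ p * √(2 * Real.pi * ξ / (3 * L)) by ring] at htot
  refine htot.congr' ?_
  filter_upwards [eventually_ge_atTop 1, hν.eventually_ge_atTop 1] with N hN1 hν1
  have hν0 : 0 < ν N := by linarith
  have hlap : ∀ k : ℕ, ν N ^ p * Real.exp (3 / 2 * L * ξ * ν N) * (Real.exp (-(L * k)) *
      (2 * (spectralWeight s k 1 * Real.cos (Real.pi / k) ^ (2 * N)))) =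
      2 * laplaceTerm L ξ p γ N (ν N) k := by
    intro k
    rcases Nat.eq_zero_or_pos k with rfl | hk
    · simp [laplaceTerm, h0, spectralWeight_of_le_one]
    · have hk' : (k : ℝ) ≠ 0 := by positivity
      rw [laplaceTerm, sub_eq_add_neg, Real.exp_add, hγ, div_pow]
      field_simp
  have hls := (summable_laplaceTerm hL ξ p hK h0 N hν0.le).mul_left 2
  have hA : ν N ^ p * Real.exp (3 / 2 * L * ξ * ν N) *
      ∑' k : ℕ, Real.exp (-(L * k)) * spectralSum s N k =
      2 * (∑' k, laplaceTerm L ξ p γ N (ν N) k) +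
      ν N ^ p * Real.exp (3 / 2 * L * ξ * ν N) * ∑' k, D N k := by
    rw [← tsum_mul_left, ← tsum_mul_left, ← tsum_mul_left,
      ← hls.tsum_add ((hDsum N hN1 hν1).mul_left _)]
    refine tsum_congr fun k => ?_
    rw [← hlap k, hD]
    ring
  linear_combination (-(√(ν N))⁻¹) * hA

end Laplace

/-! ### Asymptotics of the first spectral weight -/

/-- The matrix `sin (π j b / k)` is symmetric in `j` and `b`, so the norm of the first eigenfunction
is the case `n = 0`, `u = v = 1` of the kernel. -/
theorem spectralWeight_one_of_two_le {k : ℕ} (hk : 2 ≤ k) : spectralWeight 1 k 1 = 1 := by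
  have h := pathKernel_zero (k := k) (u := 1) (v := 1) (by norm_num) (by omega) (by norm_num)
    (by omega)
  obtain ⟨m, rfl⟩ : ∃ m, k = m + 1 := ⟨k - 1, by omega⟩
  rw [pathKernel, Finset.sum_range_succ', if_pos rfl] at h
  rw [spectralWeight]
  refine Eq.trans ?_ h
  congr 1
  simp only [Nat.add_sub_cancel, one_pow, one_mul, pow_zero, mul_one, Nat.cast_zero, zero_mul,
    Real.sin_zero, add_zero, Nat.cast_one, Int.cast_one]
  refine Finset.sum_congr rfl fun b _ => ?_
  rw [← sq]
  congr 2
  push_cast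
  ring

/-- `(b + 1)² = 2 C(b + 2, 2) - C(b + 1, 1)`, and both binomial series are known. -/
theorem hasSum_pow_mul_succ_sq {s : ℝ} (hs : 0 ≤ s) (hs1 : s < 1) :
    HasSum (fun b : ℕ => s ^ b * ((b : ℝ) + 1) ^ 2) ((1 + s) / (1 - s) ^ 3) := by
  have hn : ‖s‖ < 1 := by rwa [Real.norm_of_nonneg hs]
  have h := ((hasSum_choose_mul_geometric_of_norm_lt_one 2 hn).mul_left 2).sub
    (hasSum_choose_mul_geometric_of_norm_lt_one 1 hn)
  have h1 : (1 - s) ≠ 0 := by linarith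
  have e : 2 * (1 / (1 - s) ^ (2 + 1)) - 1 / (1 - s) ^ (1 + 1) = (1 + s) / (1 - s) ^ 3 := by
    field_simp
    ring
  rw [e] at h
  refine h.congr_fun fun b => ?_
  rw [Nat.choose_one_right, Nat.cast_choose_two]
  push_cast
  ring

/-- For `s < 1` only bounded `b` count, and there `k sin (π (b + 1) / k) → π (b + 1)`: two powers of
`k` come from the sine near the endpoint, one from normalization. -/
theorem tendsto_cube_mul_spectralWeight {s : ℝ} (hs : 0 ≤ s) (hs1 : s < 1) :
    Tendsto (fun k : ℕ => (k : ℝ) ^ 3 * spectralWeight s k 1) atTop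
      (nhds (2 * Real.pi ^ 2 * ((1 + s) / (1 - s) ^ 3))) := by
  have hsum := hasSum_pow_mul_succ_sq hs hs1
  set f : ℕ → ℕ → ℝ := fun k b =>
    if b < k - 1 then s ^ b * (k * Real.sin (Real.pi * (b + 1) / k)) ^ 2 else 0 with hf
  have hbound : ∀ k b : ℕ, |(k : ℝ) * Real.sin (Real.pi * (b + 1) / k)| ≤ Real.pi * (b + 1) := by
    intro k b
    rcases Nat.eq_zero_or_pos k with rfl | hk
    · simp; positivity
    · have hk' : (0 : ℝ) < k := by exact_mod_cast hk
      rw [abs_mul, abs_of_pos hk']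
      calc (k : ℝ) * |Real.sin (Real.pi * (b + 1) / k)| ≤ k * |Real.pi * (b + 1) / k| :=
            mul_le_mul_of_nonneg_left Real.abs_sin_le_abs hk'.le
        _ = Real.pi * (b + 1) := by
            rw [abs_of_nonneg (by positivity)]
            field_simp
  have hT : Tendsto (fun k => ∑' b, f k b) atTop
      (nhds (∑' b : ℕ, Real.pi ^ 2 * (s ^ b * ((b : ℝ) + 1) ^ 2))) := by
    refine tendsto_tsum_of_dominated_convergence (hsum.summable.mul_left (Real.pi ^ 2)) ?_ ?_
    · intro b
      have h1 : Tendsto (fun k : ℕ => Real.pi * (b + 1) * Real.sinc (Real.pi * (b + 1) / k)) atTop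
          (nhds (Real.pi * (b + 1))) := by
        have h2 : Tendsto (fun k : ℕ => Real.pi * (b + 1) / (k : ℝ)) atTop (nhds 0) :=
          tendsto_const_div_atTop_nhds_zero_nat _
        have h3 := (Real.continuous_sinc.tendsto 0).comp h2
        rw [Real.sinc_zero] at h3
        simpa [Function.comp_def] using h3.const_mul (Real.pi * (b + 1))
      have h4 := (h1.pow 2).const_mul (s ^ b)
      rw [show Real.pi ^ 2 * (s ^ b * ((b : ℝ) + 1) ^ 2) = s ^ b * (Real.pi * (b + 1)) ^ 2 by ring]
      refine h4.congr' ?_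
      filter_upwards [eventually_ge_atTop (b + 2)] with k hk
      have hk' : (k : ℝ) ≠ 0 := by
        have : k ≠ 0 := by omega
        exact_mod_cast this
      simp only [hf]
      rw [if_pos (by omega), Real.sinc_of_ne_zero (by positivity)]
      congr 2
      field_simp
    · refine Eventually.of_forall fun k b => ?_
      simp only [hf]
      split_ifs
      · rw [norm_mul, Real.norm_of_nonneg (by positivity), norm_pow, Real.norm_eq_abs]
        calc _ ≤ s ^ b * (Real.pi * (b + 1)) ^ 2 := by
              gcongr
              exact hbound k b
          _ = _ := by ring
      · rw [norm_zero]
        positivity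
  rw [tsum_mul_left, hsum.tsum_eq] at hT
  have hT2 := hT.const_mul 2
  rw [← mul_assoc] at hT2
  refine hT2.congr fun k => ?_
  have e : ∑' b, f k b = ∑ b ∈ Finset.range (k - 1),
      s ^ b * (k * Real.sin (Real.pi * (b + 1) / k)) ^ 2 := by
    rw [tsum_eq_sum (s := Finset.range (k - 1))
      (fun b hb => if_neg (by simpa using hb))]
    exact Finset.sum_congr rfl fun b hb => if_pos (Finset.mem_range.1 hb)
  rw [e, spectralWeight, Finset.mul_sum, Finset.mul_sum, Finset.mul_sum]
  refine Finset.sum_congr rfl fun b hb => ?_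
  have hk' : (k : ℝ) ≠ 0 := by
    have := Finset.mem_range.1 hb
    have : k ≠ 0 := by omega
    exact_mod_cast this
  rw [Nat.cast_one, one_mul]
  field_simp

/-! ### The return probabilities -/

/-- With `k = m + 2 = a + b + 2`, the weight `q⁻ᵃ r⁻ᵇ` is `q² q⁻ᵏ (q / r)ᵇ`, and reflecting the path
turns `sin²` at `a + 1` into `sin²` at `b + 1`. -/
theorem sum_antidiagonal_pathKernel {q r : ℕ} (hq : 0 < q) (N m : ℕ) :
    ∑ p ∈ Finset.HasAntidiagonal.antidiagonal m, (q : ℝ)⁻¹ ^ p.1 * (r : ℝ)⁻¹ ^ p.2 *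
      pathKernel (p.1 + p.2 + 2) (2 * N) (p.1 + 1) (p.1 + 1) =
    (q : ℝ) ^ 2 * 4 ^ N * ((q : ℝ)⁻¹ ^ (m + 2) * spectralSum (q / r) N (m + 2)) := by
  have hq' : (q : ℝ) ≠ 0 := by positivity
  rw [← Finset.Nat.sum_antidiagonal_swap, Finset.Nat.sum_antidiagonal_eq_sum_range_succ_mk]
  have hterm : ∀ b ∈ Finset.range (m + 1),
      (q : ℝ)⁻¹ ^ (m - b) * (r : ℝ)⁻¹ ^ b *
        pathKernel (m - b + b + 2) (2 * N) ((m - b : ℕ) + 1) ((m - b : ℕ) + 1) =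
      (q : ℝ) ^ 2 * 4 ^ N * (q : ℝ)⁻¹ ^ (m + 2) * ∑ j ∈ Finset.range (m + 2),
        2 / (m + 2 : ℕ) * ((q / r : ℝ) ^ b *
          Real.sin (j * (Real.pi * (b + 1) / (m + 2 : ℕ))) ^ 2) *
          Real.cos (j * (Real.pi / (m + 2 : ℕ))) ^ (2 * N) := by
    intro b hb
    have hbm : b ≤ m := by
      have := Finset.mem_range.1 hb
      omega
    rw [Nat.sub_add_cancel hbm, pathKernel, Finset.mul_sum, Finset.mul_sum, Finset.mul_sum]
    refine Finset.sum_congr rfl fun j _ => ?_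
    have hsin : Real.sin (j * (Real.pi * (((m - b : ℕ) : ℤ) + 1 : ℤ) / (m + 2 : ℕ))) ^ 2 =
        Real.sin (j * (Real.pi * (b + 1) / (m + 2 : ℕ))) ^ 2 := by
      have e : (j : ℝ) * (Real.pi * (((m - b : ℕ) : ℤ) + 1 : ℤ) / (m + 2 : ℕ)) =
          j * Real.pi - j * (Real.pi * (b + 1) / (m + 2 : ℕ)) := by
        push_cast [Nat.cast_sub hbm]
        field_simp
        ring
      rw [e, Real.sin_sub, Real.sin_nat_mul_pi, Real.cos_nat_mul_pi, zero_mul, zero_sub, neg_sq,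
        mul_pow, ← pow_mul, mul_comm j 2, pow_mul]
      simp
    have hpow : (q : ℝ)⁻¹ ^ (m - b) * (r : ℝ)⁻¹ ^ b =
        (q : ℝ) ^ 2 * (q : ℝ)⁻¹ ^ (m + 2) * (q / r : ℝ) ^ b := by
      have e : (q : ℝ)⁻¹ ^ (m + 2) = (q : ℝ)⁻¹ ^ (m - b) * (q : ℝ)⁻¹ ^ b * (q : ℝ)⁻¹ ^ 2 := by
        rw [← pow_add, ← pow_add]
        congr 1
        omega
      rw [e, div_eq_mul_inv, mul_pow]
      have e2 : (q : ℝ)⁻¹ ^ b * (q : ℝ) ^ b = 1 := by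
        rw [← mul_pow, inv_mul_cancel₀ hq', one_pow]
      have e3 : (q : ℝ) ^ 2 * (q : ℝ)⁻¹ ^ 2 = 1 := by
        rw [← mul_pow, mul_inv_cancel₀ hq', one_pow]
      linear_combination (-(q : ℝ)⁻¹ ^ (m - b) * (r : ℝ)⁻¹ ^ b * ((q : ℝ)⁻¹ ^ b * (q : ℝ) ^ b)) * e3
        - ((q : ℝ)⁻¹ ^ (m - b) * (r : ℝ)⁻¹ ^ b) * e2
    rw [hpow, ← sq, hsin, mul_pow 2, pow_mul 2]
    norm_num
    ring
  simp only [Prod.swap_prod_mk]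
  rw [Finset.sum_congr rfl hterm, ← Finset.mul_sum, mul_assoc]
  congr 2
  rw [Finset.sum_comm, spectralSum]
  refine Finset.sum_congr rfl fun j _ => ?_
  rw [spectralWeight, ← Finset.sum_mul, ← Finset.mul_sum]
  rfl

theorem tsum_pathKernel {q r : ℕ} (hq : 2 ≤ q) (hr : 2 ≤ r) (N : ℕ) :
    ∑' p : ℕ × ℕ, (q : ℝ)⁻¹ ^ p.1 * (r : ℝ)⁻¹ ^ p.2 *
      pathKernel (p.1 + p.2 + 2) (2 * N) (p.1 + 1) (p.1 + 1) =
    (q : ℝ) ^ 2 * 4 ^ N * ∑' k : ℕ, Real.exp (-(Real.log q * k)) * spectralSum (q / r) N k := by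
  have hq0 : (0 : ℝ) < q := by
    have : 0 < q := by omega
    exact_mod_cast this
  have hsum : Summable fun p : ℕ × ℕ => (q : ℝ)⁻¹ ^ p.1 * (r : ℝ)⁻¹ ^ p.2 *
      pathKernel (p.1 + p.2 + 2) (2 * N) (p.1 + 1) (p.1 + 1) := by
    refine Summable.of_norm_bounded (((summable_inv_pow hq).mul_of_nonneg (summable_inv_pow hr)
      (fun a => by positivity) (fun a => by positivity)).mul_right (2 * 2 ^ (2 * N))) fun p => ?_
    rw [norm_mul, Real.norm_of_nonneg (by positivity), Real.norm_eq_abs]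
    exact mul_le_mul_of_nonneg_left (abs_pathKernel_le _ _ _ _) (by positivity)
  have h1 := (Finset.HasAntidiagonal.sigmaAntidiagonalEquivProd (A := ℕ)).hasSum_iff.2 hsum.hasSum
  have h2 := h1.sigma (fun m => hasSum_fintype _)
  have h3 : ∀ m : ℕ, ∑ p : Finset.HasAntidiagonal.antidiagonal m, ((fun p : ℕ × ℕ => (q : ℝ)⁻¹ ^ p.1 *
      (r : ℝ)⁻¹ ^ p.2 * pathKernel (p.1 + p.2 + 2) (2 * N) (p.1 + 1) (p.1 + 1)) ∘
        (Finset.HasAntidiagonal.sigmaAntidiagonalEquivProd (A := ℕ))) ⟨m, p⟩ =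
      (q : ℝ) ^ 2 * 4 ^ N * ((q : ℝ)⁻¹ ^ (m + 2) * spectralSum (q / r) N (m + 2)) := by
    intro m
    rw [← sum_antidiagonal_pathKernel (r := r) (by omega) N m]
    exact Finset.sum_coe_sort (Finset.HasAntidiagonal.antidiagonal m) (fun p : ℕ × ℕ =>
      (q : ℝ)⁻¹ ^ p.1 * (r : ℝ)⁻¹ ^ p.2 *
        pathKernel (p.1 + p.2 + 2) (2 * N) (p.1 + 1) (p.1 + 1))
  simp_rw [h3] at h2
  have hexp : ∀ k : ℕ, Real.exp (-(Real.log q * k)) = (q : ℝ)⁻¹ ^ k := by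
    intro k
    rw [← neg_mul, mul_comm, Real.exp_nat_mul, Real.exp_neg, Real.exp_log hq0]
  simp_rw [hexp]
  rw [← tsum_mul_left]
  -- The sum starts at `k = 2`; the added terms `k = 0, 1` vanish.
  refine (((hasSum_nat_add_iff 2).1 h2).tsum_eq.trans ?_).symm
  simp [Finset.sum_range_succ, spectralSum, spectralWeight_index_zero]

theorem rpow_two_thirds_pow_three {x : ℝ} (hx : 0 ≤ x) : (x ^ (2 / 3 : ℝ)) ^ 3 = x ^ 2 := by
  rw [← Real.rpow_natCast, ← Real.rpow_mul hx, ← Real.rpow_natCast]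
  norm_num

namespace DL

theorem nStep_origin_origin {q r : ℕ} (hq : 2 ≤ q) (hr : 2 ≤ r) {V W : Type*} (T : HomTree q V)
    (S : HomTree r W) {α : ℝ} (hα0 : 0 < α) (hα1 : α < 1) (N : ℕ) :
    nStep α (2 * N) (origin T S) (origin T S) =
      (1 - (q : ℝ)⁻¹) * (1 - (r : ℝ)⁻¹) * (q : ℝ) ^ 2 * (4 * α * (1 - α)) ^ N *
        ∑' k : ℕ, Real.exp (-(Real.log q * k)) * spectralSum (q / r) N k := by
  rw [nStep_origin hq hr hα0 hα1]
  have hβ : 0 ≤ α * (1 - α) := mul_nonneg hα0.le (by linarith)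
  have hT : T.up (origin T S).1.1 = 0 := T.up_ray 0
  have hS : S.up (origin T S).1.2 = 0 := S.up_ray 0
  have hh : T.hor (origin T S).1.1 = 0 := T.hor_root
  have hterm : ∀ p : ℕ × ℕ, levelTerm T S α (2 * N) (origin T S).1.1 (origin T S).1.2 p =
      (1 - (q : ℝ)⁻¹) * (1 - (r : ℝ)⁻¹) * (α * (1 - α)) ^ N * ((q : ℝ)⁻¹ ^ p.1 * (r : ℝ)⁻¹ ^ p.2 *
        pathKernel (p.1 + p.2 + 2) (2 * N) (p.1 + 1) (p.1 + 1)) := by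
    intro p
    rw [levelTerm, hT, hS, hh, levelWeight, levelWeight, if_pos (Nat.zero_le _),
      if_pos (Nat.zero_le _), killedKernel, if_pos (by omega), pow_mul, Real.sq_sqrt hβ, neg_zero,
      zpow_zero, zero_add]
    ring
  simp_rw [hterm]
  rw [tsum_mul_left, tsum_pathKernel hq hr]
  rw [mul_assoc 4 α, mul_pow 4]
  ring

/-! ### The constants expressed through `log q` and `ξ₁` -/

section constants

variable {q : ℕ} (hq : 2 ≤ q)
include hq

theorem log_pos_of_two_le : 0 < Real.log q := Real.log_pos (by exact_mod_cast hq)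

theorem xi1_pos : 0 < xi1 q := by
  have := log_pos_of_two_le hq
  unfold xi1
  positivity

theorem log_mul_xi1_pow : Real.log q * xi1 q ^ 3 = 2 * Real.pi ^ 2 := by
  have := log_pos_of_two_le hq
  rw [xi1, ← Real.rpow_natCast, ← Real.rpow_mul (by positivity)]
  norm_num
  field_simp

theorem B1_eq : B1 q = 3 / 2 * Real.log q * xi1 q := by
  have hL := log_pos_of_two_le hq
  have hξ := xi1_pos hq
  have hB : 0 ≤ B1 q := by unfold B1; positivity
  refine (pow_left_inj₀ hB (by positivity) three_ne_zero).1 ?_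
  have h := log_mul_xi1_pow hq
  rw [B1, mul_pow, rpow_two_thirds_pow_three (by positivity), mul_pow, mul_pow]
  linear_combination (-27 / 8 * Real.log q ^ 2) * h

theorem C1_eq : C1 q = 3 * Real.log q / xi1 q := by
  have hL := log_pos_of_two_le hq
  have hξ := xi1_pos hq
  have hC : 0 ≤ C1 q := by unfold C1; positivity
  refine (pow_left_inj₀ hC (by positivity) three_ne_zero).1 ?_
  have h := log_mul_xi1_pow hq
  rw [C1, mul_pow, rpow_two_thirds_pow_three (by positivity), div_pow (3 * Real.log q)]
  field_simp
  linear_combination 216 * h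

end constants

/-- Both cases at once: `p` is the decay order of the first spectral weight. The width of the
Laplace peak contributes `N^(1/6)` and the weight `N^(-p/3)`. -/
theorem return_isEquivalent {q r : ℕ} (hq : 2 ≤ q) (hr : 2 ≤ r) {V W : Type*} (T : HomTree q V)
    (S : HomTree r W) {α : ℝ} (hα0 : 0 < α) (hα1 : α < 1) (hqr : q ≤ r) (p : ℕ) {κ A e : ℝ}
    (hκ : Tendsto (fun k : ℕ => (k : ℝ) ^ p * spectralWeight (q / r) k 1) atTop (nhds κ))
    (hκ0 : 0 < κ) (he : e = 1 / 6 - p / 3)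
    (hA : A = (1 - (q : ℝ)⁻¹) * (1 - (r : ℝ)⁻¹) * (q : ℝ) ^ 2 *
      (2 * κ * (xi1 q)⁻¹ ^ p * (2 * Real.pi / C1 q) ^ (1 / 2 : ℝ))) :
    (fun N : ℕ => nStep α (2 * N) (origin T S) (origin T S)) ~[atTop]
      (fun N : ℕ => A * (4 * α * (1 - α)) ^ N *
        Real.exp (-B1 q * (N : ℝ) ^ (1 / 3 : ℝ)) * (N : ℝ) ^ e) := by
  have hL := log_pos_of_two_le hq
  have hξ := xi1_pos hq
  have hq' : (2 : ℝ) ≤ q := by exact_mod_cast hq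
  have hr' : (2 : ℝ) ≤ r := by exact_mod_cast hr
  set ν : ℕ → ℝ := fun N => (N : ℝ) ^ (1 / 3 : ℝ) with hνdef
  have hν : Tendsto ν atTop atTop :=
    (tendsto_rpow_atTop (by norm_num)).comp tendsto_natCast_atTop_atTop
  have hN : ∀ N, ν N ^ 3 = N := fun N => by
    simp only [hνdef]
    rw [← Real.rpow_natCast, ← Real.rpow_mul N.cast_nonneg]
    norm_num
  have hlim := tendsto_tsum_spectralSum hL hξ (log_mul_xi1_pow hq) (s := q / r) (by positivity)
    ((div_le_one (by linarith)).2 (by exact_mod_cast hqr)) p hκ hν hN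
  set c := (1 - (q : ℝ)⁻¹) * (1 - (r : ℝ)⁻¹) * (q : ℝ) ^ 2 with hc
  have hc0 : 0 < c := by
    have h1 : (q : ℝ)⁻¹ < 1 := inv_lt_one_of_one_lt₀ (by linarith)
    have h2 : (r : ℝ)⁻¹ < 1 := inv_lt_one_of_one_lt₀ (by linarith)
    have h3 : 0 < 1 - (q : ℝ)⁻¹ := by linarith
    have h4 : 0 < 1 - (r : ℝ)⁻¹ := by linarith
    positivity
  have hAeq : c * (2 * κ * (xi1 q)⁻¹ ^ p * √(2 * Real.pi * xi1 q / (3 * Real.log q))) = A := by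
    have e1 : 2 * Real.pi / (3 * Real.log q / xi1 q) =
        2 * Real.pi * xi1 q / (3 * Real.log q) := by field_simp
    rw [hA, C1_eq hq, ← Real.sqrt_eq_rpow, e1]
  have hA0 : 0 < A := by rw [← hAeq]; positivity
  have hlim2 := (hlim.const_mul c).mul_const A⁻¹
  rw [hAeq, mul_inv_cancel₀ hA0.ne'] at hlim2
  refine isEquivalent_of_tendsto_one (hlim2.congr' ?_)
  filter_upwards [eventually_ge_atTop 1] with N hN1
  have hN0 : (0 : ℝ) < N := by exact_mod_cast hN1
  have hν0 : 0 < ν N := by simp only [hνdef]; positivity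
  have hpow : (N : ℝ) ^ e * (ν N ^ p * (√(ν N))⁻¹) = 1 := by
    simp only [hνdef]
    rw [Real.sqrt_eq_rpow, ← Real.rpow_natCast, ← Real.rpow_neg (by positivity),
      ← Real.rpow_mul hN0.le, ← Real.rpow_mul hN0.le, ← Real.rpow_add hN0, ← Real.rpow_add hN0, he]
    convert Real.rpow_zero (N : ℝ) using 2
    ring
  have hexp : Real.exp (-B1 q * ν N) * Real.exp (3 / 2 * Real.log q * xi1 q * ν N) = 1 := by
    rw [← Real.exp_add, B1_eq hq]
    convert Real.exp_zero using 2
    ring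
  have h4 : 0 < 4 * α * (1 - α) := mul_pos (by linarith) (by linarith)
  have hNe : 0 < (N : ℝ) ^ e := by positivity
  rw [Pi.div_apply, nStep_origin_origin hq hr T S hα0 hα1, eq_div_iff (by positivity)]
  change _ * (A * (4 * α * (1 - α)) ^ N * Real.exp (-B1 q * ν N) * (N : ℝ) ^ e) = _
  generalize ∑' k : ℕ, Real.exp (-(Real.log q * k)) * spectralSum (q / r) N k = Z
  calc _ = c * (4 * α * (1 - α)) ^ N * Z * (A * A⁻¹) * ((N : ℝ) ^ e * (ν N ^ p * (√(ν N))⁻¹)) *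
        (Real.exp (-B1 q * ν N) * Real.exp (3 / 2 * Real.log q * xi1 q * ν N)) := by ring
    _ = _ := by rw [hpow, hexp, mul_inv_cancel₀ hA0.ne', mul_one, mul_one, mul_one]

end DL

theorem corollary7p2 {q r : ℕ} (hq : 2 ≤ q) {V W : Type*} (T : HomTree q V) (S : HomTree r W)
    (α : ℝ) (hα0 : 0 < α) (hα1 : α < 1) :
    (q < r →
      (fun N : ℕ => DL.nStep α (2 * N) (DL.origin T S) (DL.origin T S)) ~[atTop]
        (fun N : ℕ => DL.A1 q r * (4 * α * (1 - α)) ^ N *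
          Real.exp (-DL.B1 q * (N : ℝ) ^ (1 / 3 : ℝ)) * (N : ℝ) ^ (-5 / 6 : ℝ))) ∧
    (r = q →
      (fun N : ℕ => DL.nStep α (2 * N) (DL.origin T S) (DL.origin T S)) ~[atTop]
        (fun N : ℕ => DL.A1bar q * (4 * α * (1 - α)) ^ N *
          Real.exp (-DL.B1 q * (N : ℝ) ^ (1 / 3 : ℝ)) * (N : ℝ) ^ (1 / 6 : ℝ))) := by
  have hq0 : (0 : ℝ) < q := by
    have : 0 < q := by omega
    exact_mod_cast this
  constructor
  · intro hqr
    have hqr' : (q : ℝ) < r := by exact_mod_cast hqr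
    have hr0 : (0 : ℝ) < r := hq0.trans hqr'
    have hs1 : (q / r : ℝ) < 1 := (div_lt_one hr0).2 hqr'
    have hd : 0 < (r : ℝ) - q := sub_pos.2 hqr'
    have hd' : 0 < 1 - (q / r : ℝ) := sub_pos.2 hs1
    -- Here `p = 3` and `κ = 2π² (1 + s) / (1 - s)³` with `s = q / r`, the source of `(q + r)` and
    -- `(r - q)³` in the constant.
    refine DL.return_isEquivalent hq (hq.trans hqr.le) T S hα0 hα1 hqr.le 3
      (tendsto_cube_mul_spectralWeight (by positivity) hs1) (by positivity) (by norm_num) ?_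
    rw [DL.A1]
    have e : (1 - (q / r : ℝ)) = (r - q) / r := by field_simp
    rw [e]
    field_simp
    ring
  · rintro rfl
    refine DL.return_isEquivalent hq hq T S hα0 hα1 le_rfl 0 (κ := 1) ?_ one_pos (by norm_num) ?_
    · refine tendsto_const_nhds.congr' ?_
      filter_upwards [eventually_ge_atTop 2] with k hk
      rw [div_self hq0.ne', spectralWeight_one_of_two_le hk, pow_zero, mul_one]
    · rw [DL.A1bar]
      field_simp
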